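/- Let $M$ be a smooth manifold of dimension $2n+1$ (Hausdorff, second countable, without boundary) with a strongly pseudoconvex CR structure $E_{1,0}\subset TM\otimes\mathbb{C}$ of hypersurface type. Write $E_{0,1}=\overline{E_{1,0}}$, let $E\subset TM$ be the Levi distribution, so that $E\otimes\mathbb{C}=E_{1,0}\oplus E_{0,1}$, and let $J$ be the complex structure of $E$ whose $+i$-eigenbundle is $E_{1,0}$. Let $\theta$ be a contact form with $\ker\theta=E$ such that the Webster metric $$g_\theta(X,Y)=-d\theta(X,JY)+\theta(X)\theta(Y)$$ is Riemannian. Here $\xi$ is the Reeb field of $\theta$ (that is, $\theta(\xi)=1$ and $\iota(\xi)d\theta=0$), $J$ is extended to $TM$ by $J\xi=0$, and $d\theta(X,Y)=\frac12\big(X\theta(Y)-Y\theta(X)-\theta([X,Y])\big)$. Let $\nabla^{TW}$ be the Tanaka–Webster connection, the linear connection on $TM$ that preserves $\Gamma(E)$, satisfies $\nabla^{TW}J=0$, $\nabla^{TW}g_\theta=0$, $\nabla^{TW}\theta=0$, and whose torsion $T$ satisfies $T(Z,W)=0$ and $T(Z,\overline W)=2\,d\theta(Z,\overline W)\,\xi$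 for $Z,W\in E_{1,0}$, and $T(\xi,JX)=-J\,T(\xi,X)$ for $X\in TM$. By the splitting $TM=E\oplus\mathbb{R}\xi$, regard $E^*$ as a subbundle of $T^*M$ and $E^{0,1}=(E_{0,1})^*$ as a subbundle of $T^*M\otimes\mathbb{C}$. Let $\mathbb{C}\mathrm{l}(E)$ be the bundle whose fibre at $x$ is the complexified Clifford algebra of $E_x^*$ with the metric dual to $g_\theta|_E$, with the relations $\alpha\cdot\alpha=-|\alpha|^2$ for $\alpha\in E_x^*$. Let $\mathcal{S}=\bigwedge E^{0,1}$, with the action $\mathbf{c}:\mathbb{C}\mathrm{l}(E)\to\mathrm{End}(\mathcal{S})$ of complex algebras determined by $$\mathbf{c}(\alpha)\nu=\sqrt2\,\big(\alpha^{0,1}\wedge\nu-\iota(\alpha^{1,0})\nu\big),\qquad \alpha\in E^*,\ \nu\in\mathcal{S},$$ where $\iota(\alpha^{1,0})$ is contraction with the vector of $E_{0,1}$ that corresponds to $\alpha^{1,0}\in(E_{1,0})^*$ under the complex bilinear extension of $g_\theta$. The connection $\nabla^{TW}$ induces dual connections on $E^*$ and $E^{0,1}$ and, by extending these with the Leibniz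 rule for products and multiplication by smooth complex functions, a connection on $\mathbb{C}\mathrm{l}(E)$, again denoted $\nabla^{TW}$, and a connection $\nabla$ on $\mathcal{S}$. Then $\nabla$ is a CR-Clifford connection: it is a connection on the complex vector bundle $\mathcal{S}$, the action $\mathbf{c}$ maps smooth sections to smooth sections, and for every smooth section $a$ of $\mathbb{C}\mathrm{l}(E)$ and every smooth vector field $X$ on $M$, $$[\nabla_X,\mathbf{c}(a)]=\mathbf{c}(\nabla^{TW}_X a)$$ as operators on the smooth sections of $\mathcal{S}$. -/

import Mathlib

open Bundle Manifold VectorField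
open scoped ContDiff Topology TensorProduct

noncomputable section

namespace CRClifford

section Forms

variable {F : Type*} [NormedAddCommGroup F] [NormedSpace ℝ F]
  {H : Type*} [TopologicalSpace H] (I : ModelWithCorners ℝ F H)
  {M : Type*} [TopologicalSpace M] [ChartedSpace H M] [IsManifold I ∞ M]

/-- Smooth vector fields. -/
def SmoothField (X : Π x : M, TangentSpace I x) : Prop :=
  ContMDiff I I.tangent ∞ (fun x ↦ (⟨x, X x⟩ : TangentBundle I M))

/-- The fibre at `x` of the bundle of `W`-valued one-forms (note `Trivial M W x = W`). For `W = ℝ`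
this is the cotangent space, for `W = ℂ` the complexified cotangent space. -/
abbrev Form (W : Type*) [NormedAddCommGroup W] [NormedSpace ℝ W] (x : M) : Type _ :=
  TangentSpace I x →L[ℝ] Trivial M W x

variable {I} {W : Type*} [NormedAddCommGroup W] [NormedSpace ℝ W]

/-- Smooth `W`-valued one-forms. -/
def SmoothForm (α : Π x : M, Form I W x) : Prop :=
  ContMDiff I (I.prod 𝓘(ℝ, F →L[ℝ] W)) ∞
    (fun x ↦ TotalSpace.mk' (F →L[ℝ] W)
      (E := fun x : M ↦ TangentSpace I x →L[ℝ] Trivial M W x) x (α x))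

/-- Smooth fields of endomorphisms of the tangent bundle. -/
def SmoothEnd (A : Π x : M, TangentSpace I x →L[ℝ] TangentSpace I x) : Prop :=
  ContMDiff I (I.prod 𝓘(ℝ, F →L[ℝ] F)) ∞
    (fun x ↦ TotalSpace.mk' (F →L[ℝ] F)
      (E := fun x : M ↦ TangentSpace I x →L[ℝ] TangentSpace I x) x (A x))

theorem SmoothForm.mdifferentiableAt_apply {α : Π x : M, Form I W x}
    (hα : SmoothForm α) {Y : Π x : M, TangentSpace I x} {x : M} (hY : MDiffAt (T% Y) x) :
    MDifferentiableAt I 𝓘(ℝ, W) (fun y ↦ α y (Y y)) x := by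
  have h1 := (hα.mdifferentiable (by simp)) x
  have := MDifferentiableAt.clm_bundle_apply (F₁ := F) (F₂ := W) (b := fun x : M => x)
    (E₁ := (TangentSpace I : M → Type _)) (E₂ := Trivial M W) (ϕ := α) (v := Y) (IB := I) h1 hY
  simpa [mdifferentiableAt_section] using this

theorem SmoothEnd.mdifferentiableAt_apply {A : Π x : M, TangentSpace I x →L[ℝ] TangentSpace I x}
    (hA : SmoothEnd A) {Y : Π x : M, TangentSpace I x} {x : M} (hY : MDiffAt (T% Y) x) :
    MDiffAt (T% (fun y ↦ A y (Y y))) x := by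
  have h1 := (hA.mdifferentiable (by simp)) x
  exact MDifferentiableAt.clm_bundle_apply (F₁ := F) (F₂ := F) (b := fun x : M => x)
    (E₁ := (TangentSpace I : M → Type _)) (E₂ := (TangentSpace I : M → Type _))
    (ϕ := A) (v := Y) (IB := I) h1 hY

set_option linter.unusedSectionVars false in
theorem mvfderiv_clm_apply {W' : Type*} [NormedAddCommGroup W'] [NormedSpace ℝ W']
    (L : W →L[ℝ] W') {f : M → W} {x : M} (hf : MDifferentiableAt I 𝓘(ℝ, W) f x)
    (v : TangentSpace I x) :
    mvfderiv I (fun y ↦ L (f y)) x v = L (mvfderiv I f x v) := by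
  have h := (L.hasMFDerivAt (x := f x)).comp x hf.hasMFDerivAt
  have h' : mfderiv I 𝓘(ℝ, W') (fun y ↦ L (f y)) x = L.comp (mfderiv I 𝓘(ℝ, W) f x) := h.mfderiv
  simp only [mvfderiv, h']
  rfl

/-- Cartan's formula for the exterior derivative of a one-form, with the factor `1/2`:
`dθ(X, Y) = (X θ(Y) - Y θ(X) - θ([X, Y])) / 2`. -/
def extDerivFun (θ : Π x : M, Form I ℝ x) (x : M) (X Y : Π x : M, TangentSpace I x) : ℝ :=
  (1 / 2 : ℝ) * (mvfderiv I (fun y ↦ (θ y (Y y) : ℝ)) x (X x)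
    - mvfderiv I (fun y ↦ (θ y (X y) : ℝ)) x (Y x) - θ x (mlieBracket I X Y x))

set_option linter.unusedSectionVars false in
theorem extDerivFun_swap (θ : Π x : M, Form I ℝ x) (x : M) (X Y : Π x : M, TangentSpace I x) :
    extDerivFun θ x X Y = - extDerivFun θ x Y X := by
  unfold extDerivFun
  rw [mlieBracket_swap_apply, map_neg]
  ring

variable [CompleteSpace F]

theorem tensorialAt_extDerivFun {θ : Π x : M, Form I ℝ x} (hθ : SmoothForm θ) (x : M)
    (X : Π x : M, TangentSpace I x) (_hX : MDiffAt (T% X) x) :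
    TensorialAt I F (extDerivFun θ x X) x where
  smul {f Y} hf hY := by
    have hY' := hθ.mdifferentiableAt_apply hY
    have h : (fun y ↦ (θ y ((f • Y) y) : ℝ)) = (fun y ↦ f y * θ y (Y y)) := by
      ext y; simp
    unfold extDerivFun
    rw [h, mvfderiv_fun_mul hf hY', mlieBracket_smul_right hf hY]
    simp
    ring
  add {Y Y'} hY hY' := by
    have h1 := hθ.mdifferentiableAt_apply hY
    have h2 := hθ.mdifferentiableAt_apply hY'
    have h : (fun y ↦ (θ y ((Y + Y') y) : ℝ)) = (fun y ↦ (θ y (Y y) : ℝ) + θ y (Y' y)) := by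
      ext y; simp
    unfold extDerivFun
    rw [h, mvfderiv_fun_add h1 h2, mlieBracket_add_right hY hY']
    simp
    ring

theorem tensorialAt_extDerivFun' {θ : Π x : M, Form I ℝ x} (hθ : SmoothForm θ) (x : M)
    (Y : Π x : M, TangentSpace I x) (hY : MDiffAt (T% Y) x) :
    TensorialAt I F (fun X ↦ extDerivFun θ x X Y) x where
  smul {f X} hf hX := by
    simp only [extDerivFun_swap θ x _ Y]
    rw [(tensorialAt_extDerivFun hθ x Y hY).smul hf hX, smul_neg]
  add {X X'} hX hX' := by
    simp only [extDerivFun_swap θ x _ Y]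
    rw [(tensorialAt_extDerivFun hθ x Y hY).add hX hX', neg_add]

variable [FiniteDimensional ℝ F]

/-- The exterior derivative of a smooth one-form, as a field of bilinear forms; the bilinear form
at `x` sends `(X x, Y x)` to `extDerivFun θ x X Y`. -/
def extDeriv (θ : Π x : M, Form I ℝ x) (hθ : SmoothForm θ) (x : M) :
    TangentSpace I x →L[ℝ] TangentSpace I x →L[ℝ] ℝ :=
  TensorialAt.mkHom₂ (I := I) (F := F) (F' := F) (extDerivFun θ x) x
    (fun Y hY ↦ tensorialAt_extDerivFun' hθ x Y hY)
    (fun X hX ↦ tensorialAt_extDerivFun hθ x X hX)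

theorem extDeriv_swap (θ : Π x : M, Form I ℝ x) (hθ : SmoothForm θ) (x : M)
    (v w : TangentSpace I x) : extDeriv θ hθ x v w = - extDeriv θ hθ x w v := by
  unfold extDeriv
  rw [TensorialAt.mkHom₂_apply_eq_extend, TensorialAt.mkHom₂_apply_eq_extend, extDerivFun_swap]

set_option linter.unusedSectionVars false in
theorem tensorialAt_covForm (cov : CovariantDerivative I F (TangentSpace I : M → Type _))
    {α : Π x : M, Form I W x} (hα : SmoothForm α) (x : M) (v : TangentSpace I x) :
    TensorialAt I F (fun Y : Π x : M, TangentSpace I x ↦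
      (mvfderiv I (fun y ↦ (α y (Y y) : W)) x v - α x (cov Y x v) : W)) x where
  smul {f Y} hf hY := by
    have hY' := hα.mdifferentiableAt_apply hY
    have h : (fun y ↦ (α y ((f • Y) y) : W)) = (fun y ↦ f y • (α y (Y y) : W)) := by
      ext y; simp
    rw [h, mvfderiv_fun_smul hf hY', cov.isCovariantDerivativeOn.leibniz hY hf]
    simp [smul_sub]
  add {Y Y'} hY hY' := by
    have h1 := hα.mdifferentiableAt_apply hY
    have h2 := hα.mdifferentiableAt_apply hY'
    have h : (fun y ↦ (α y ((Y + Y') y) : W)) = (fun y ↦ (α y (Y y) : W) + α y (Y' y)) := by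
      ext y; simp
    rw [h, mvfderiv_fun_add h1 h2, cov.isCovariantDerivativeOn.add hY hY']
    simp
    abel

/-- The covariant derivative `∇_v α` at `x` of a smooth one-form for the connection dual to `cov`,
the covector that sends `Y x` to `v(α(Y)) - α(∇_v Y)` for every vector field `Y`. -/
def covForm (cov : CovariantDerivative I F (TangentSpace I : M → Type _))
    (α : Π x : M, Form I W x) (x : M) (v : TangentSpace I x) : Form I W x :=
  open Classical in
  if h : SmoothForm α then (tensorialAt_covForm cov h x v).mkHom else 0

theorem covForm_apply (cov : CovariantDerivative I F (TangentSpace I : M → Type _))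
    {α : Π x : M, Form I W x} (hα : SmoothForm α) {x : M} (v : TangentSpace I x)
    {Y : Π x : M, TangentSpace I x} (hY : MDiffAt (T% Y) x) :
    covForm cov α x v (Y x) = (mvfderiv I (fun y ↦ (α y (Y y) : W)) x v - α x (cov Y x v) : W) := by
  rw [covForm, dif_pos hα, TensorialAt.mkHom_apply _ hY]

/-- The complex tangent vector `u + i v` in `T_x M ⊗ ℂ`. -/
def cvec {x : M} (u v : TangentSpace I x) : ℂ ⊗[ℝ] TangentSpace I x :=
  (1 : ℂ) ⊗ₜ[ℝ] u + Complex.I ⊗ₜ[ℝ] v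

/-- The Webster form `g_θ(v, w) = -dθ(v, J w) + θ(v) θ(w)`. -/
def websterForm (θ : Π x : M, Form I ℝ x) (hθ : SmoothForm θ)
    (J : Π x : M, TangentSpace I x →L[ℝ] TangentSpace I x) (x : M) :
    LinearMap.BilinForm ℝ (TangentSpace I x) :=
  LinearMap.mk₂ ℝ (fun v w ↦ - extDeriv θ hθ x v (J x w) + (θ x v : ℝ) * θ x w)
    (fun _ _ _ ↦ by simp; ring) (fun _ _ _ ↦ by simp; ring)
    (fun _ _ _ ↦ by simp; ring) (fun _ _ _ ↦ by simp; ring)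

end Forms

/-- A strongly pseudoconvex CR structure (of hypersurface type) on `M`, together with a contact
form `θ` whose Webster metric is Riemannian. The Levi distribution is `E = ker θ`, and `J` is the
complex structure of `E`, extended to `TM` by `J ξ = 0`, where `ξ` is the Reeb field of `θ`. The CR
structure itself is the bundle `E_{1,0}` of `i`-eigenvectors of `J` in `TM ⊗ ℂ`. -/
structure PseudohermitianStructure {F : Type*} [NormedAddCommGroup F] [NormedSpace ℝ F]
    [CompleteSpace F] [FiniteDimensional ℝ F] {H : Type*} [TopologicalSpace H]
    (I : ModelWithCorners ℝ F H) (M : Type*) [TopologicalSpace M] [ChartedSpace H M]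
    [IsManifold I ∞ M] where
  /-- The contact form. -/
  θ : Π x : M, Form I ℝ x
  /-- The Reeb field. -/
  ξ : Π x : M, TangentSpace I x
  /-- The complex structure of `E = ker θ`, extended by `0` on the Reeb field. -/
  J : Π x : M, TangentSpace I x →L[ℝ] TangentSpace I x
  smooth_θ : SmoothForm θ
  smooth_ξ : SmoothField I ξ
  smooth_J : SmoothEnd J
  θ_ξ : ∀ x, θ x (ξ x) = (1 : ℝ)
  dθ_ξ : ∀ x v, extDeriv θ smooth_θ x (ξ x) v = 0
  J_ξ : ∀ x, J x (ξ x) = 0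
  θ_J : ∀ x v, θ x (J x v) = (0 : ℝ)
  J_J : ∀ x v, θ x v = (0 : ℝ) → J x (J x v) = -v
  /-- Formal integrability: if `Z = A + i B` and `W = C + i D` are sections of `E_{1,0}`, then so is
  `[Z, W] = ([A, C] - [B, D]) + i ([A, D] + [B, C])`. -/
  integrable : ∀ A B C D : Π x : M, TangentSpace I x,
    SmoothField I A → SmoothField I B → SmoothField I C → SmoothField I D →
    (∀ x, cvec (A x) (B x) ∈
      Module.End.eigenspace ((J x).toLinearMap.baseChange ℂ) Complex.I) →
    (∀ x, cvec (C x) (D x) ∈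
      Module.End.eigenspace ((J x).toLinearMap.baseChange ℂ) Complex.I) →
    ∀ x, cvec (mlieBracket I A C x - mlieBracket I B D x)
        (mlieBracket I A D x + mlieBracket I B C x) ∈
      Module.End.eigenspace ((J x).toLinearMap.baseChange ℂ) Complex.I
  webster_symm : ∀ x v w, websterForm θ smooth_θ J x v w = websterForm θ smooth_θ J x w v
  webster_pos : ∀ x v, v ≠ 0 → 0 < websterForm θ smooth_θ J x v v

namespace PseudohermitianStructure

variable {F : Type*} [NormedAddCommGroup F] [NormedSpace ℝ F]
  [CompleteSpace F] [FiniteDimensional ℝ F] {H : Type*} [TopologicalSpace H]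
  {I : ModelWithCorners ℝ F H} {M : Type*} [TopologicalSpace M] [ChartedSpace H M]
  [IsManifold I ∞ M] (S : PseudohermitianStructure I M)

/-- The Webster metric. -/
def g (x : M) : LinearMap.BilinForm ℝ (TangentSpace I x) :=
  websterForm S.θ S.smooth_θ S.J x

/-- The two-form `dθ`. -/
def dθ (x : M) : LinearMap.BilinForm ℝ (TangentSpace I x) :=
  (extDeriv S.θ S.smooth_θ x).toLinearMap₁₂

/-- The CR structure `E_{1,0} ⊆ TM ⊗ ℂ`, the `i`-eigenbundle of `J`. -/
def E10 (x : M) : Submodule ℂ (ℂ ⊗[ℝ] TangentSpace I x) :=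
  Module.End.eigenspace ((S.J x).toLinearMap.baseChange ℂ) Complex.I

/-- The conjugate bundle `E_{0,1} ⊆ TM ⊗ ℂ`, the `-i`-eigenbundle of `J`. -/
def E01 (x : M) : Submodule ℂ (ℂ ⊗[ℝ] TangentSpace I x) :=
  Module.End.eigenspace ((S.J x).toLinearMap.baseChange ℂ) (-Complex.I)

/-- The torsion of a linear connection, extended `ℂ`-bilinearly to `TM ⊗ ℂ`. -/
def torsionC (cov : CovariantDerivative I F (TangentSpace I : M → Type _)) (x : M) :
    LinearMap.BilinMap ℂ (ℂ ⊗[ℝ] TangentSpace I x) (ℂ ⊗[ℝ] TangentSpace I x) :=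
  LinearMap.BilinMap.baseChange ℂ (cov.torsion x).toLinearMap₁₂

/-- The two-form `dθ`, extended `ℂ`-bilinearly to `TM ⊗ ℂ`. -/
def dθC (x : M) : LinearMap.BilinForm ℂ (ℂ ⊗[ℝ] TangentSpace I x) :=
  LinearMap.BilinForm.baseChange ℂ (S.dθ x)

/-- `cov` is the Tanaka-Webster connection: a smooth linear connection on `M` that preserves
`E = ker θ`, for which `J`, `g_θ` and `θ` are parallel, and whose torsion is pure. -/
structure IsTanakaWebster (cov : CovariantDerivative I F (TangentSpace I : M → Type _)) :
    Prop where
  smooth : cov.ContMDiffCovariantDerivative ∞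
  preserves_E : ∀ Y : Π x : M, TangentSpace I x, SmoothField I Y →
    (∀ x, S.θ x (Y x) = (0 : ℝ)) → ∀ x v, S.θ x (cov Y x v) = (0 : ℝ)
  parallel_J : ∀ (Y : Π x : M, TangentSpace I x) (x : M), MDiffAt (T% Y) x →
    ∀ v, cov (fun y ↦ S.J y (Y y)) x v = S.J x (cov Y x v)
  parallel_g : ∀ (Y Z : Π x : M, TangentSpace I x) (x : M),
    MDiffAt (T% Y) x → MDiffAt (T% Z) x →
    ∀ v, mvfderiv I (fun y ↦ S.g y (Y y) (Z y)) x v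
      = S.g x (cov Y x v) (Z x) + S.g x (Y x) (cov Z x v)
  parallel_θ : ∀ (Y : Π x : M, TangentSpace I x) (x : M), MDiffAt (T% Y) x →
    ∀ v, mvfderiv I (fun y ↦ (S.θ y (Y y) : ℝ)) x v = S.θ x (cov Y x v)
  torsion_10_10 : ∀ x, ∀ z ∈ S.E10 x, ∀ w ∈ S.E10 x, torsionC cov x z w = 0
  torsion_10_01 : ∀ x, ∀ z ∈ S.E10 x, ∀ w ∈ S.E01 x,
    torsionC cov x z w = (2 * S.dθC x z w) • ((1 : ℂ) ⊗ₜ[ℝ] S.ξ x)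
  torsion_ξ : ∀ x v, cov.torsion x (S.ξ x) (S.J x v) = - S.J x (cov.torsion x (S.ξ x) v)

/-! ### The bundles `E^*`, `E^{0,1}`, `Cl(E)` and `S` -/

/-- `E_x^*`, identified by the splitting `TM = E ⊕ ℝ ξ` with the covectors that vanish on `ξ`. -/
def Estar (x : M) : Submodule ℝ (Form I ℝ x) where
  carrier := {α | α (S.ξ x) = (0 : ℝ)}
  add_mem' {a b} ha hb := by simp_all
  zero_mem' := by simp
  smul_mem' c a ha := by simp_all

/-- `E_x^{0,1}`, the dual of `E_{0,1}`, identified by the splitting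
`TM ⊗ ℂ = E_{1,0} ⊕ E_{0,1} ⊕ ℂ ξ` with the complex covectors of type `(0,1)`, that is, those whose
complex-linear extensions vanish on `E_{1,0} = {v - i J v | v ∈ E}` and on `ξ`. -/
def Eform01 (x : M) : Submodule ℂ (Form I ℂ x) where
  carrier := {β | ∀ v, β (S.J x v) = (-Complex.I * β v : ℂ)}
  add_mem' {a b} ha hb := by
    intro v
    have h1 := ha v
    have h2 := hb v
    simp only [add_apply, h1, h2, mul_add]
  zero_mem' := by simp
  smul_mem' c a ha := by
    intro v
    have h1 := ha v
    simp only [smul_apply, h1, smul_eq_mul]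
    ring

theorem θ_apply_eq (x : M) (v : TangentSpace I x) : S.g x (S.ξ x) v = (S.θ x v : ℝ) := by
  simp [g, websterForm, S.dθ_ξ, S.θ_ξ]

theorem J_J' (x : M) (v : TangentSpace I x) :
    S.J x (S.J x v) = -v + (S.θ x v : ℝ) • S.ξ x := by
  have h := S.J_J x (v - (S.θ x v : ℝ) • S.ξ x) (by simp [S.θ_ξ])
  simp only [map_sub, map_smul, S.J_ξ, smul_zero, sub_zero] at h
  rw [h]
  abel

theorem g_J_self (x : M) (v : TangentSpace I x) : S.g x v (S.J x v) = 0 := by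
  have h0 : extDeriv S.θ S.smooth_θ x v v = 0 := by
    have := extDeriv_swap S.θ S.smooth_θ x v v
    linarith
  have h1 : extDeriv S.θ S.smooth_θ x v (S.ξ x) = 0 := by
    rw [extDeriv_swap, S.dθ_ξ, neg_zero]
  simp [g, websterForm, S.J_J', S.θ_J, h0, h1]

instance (x : M) : FiniteDimensional ℝ (TangentSpace I x) :=
  inferInstanceAs (FiniteDimensional ℝ F)

theorem g_nondegenerate (x : M) : (S.g x).Nondegenerate := by
  have h : ∀ v, S.g x v v = 0 → v = 0 := fun v hv ↦ by
    by_contra hne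
    exact (S.webster_pos x v hne).ne' hv
  exact ⟨fun v hv ↦ h v (hv v), fun v hv ↦ h v (hv v)⟩

/-- The metric dual `α^♯` of a covector: `g_θ(α^♯, v) = α(v)`. -/
def sharp (x : M) : Form I ℝ x →ₗ[ℝ] TangentSpace I x :=
  ((S.g x).toDual (S.g_nondegenerate x)).symm.toLinearMap ∘ₗ
    ContinuousLinearMap.coeLM ℝ

theorem g_sharp (x : M) (α : Form I ℝ x) (v : TangentSpace I x) :
    S.g x (S.sharp x α) v = (α v : ℝ) := by
  simp [sharp]

/-- Evaluation of elements of `E_x^{0,1}` at a tangent vector. -/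
def evalAt (x : M) : TangentSpace I x →ₗ[ℝ] Module.Dual ℂ (S.Eform01 x) where
  toFun v :=
    { toFun := fun β ↦ (β.1 v : ℂ)
      map_add' := fun _ _ ↦ rfl
      map_smul' := fun _ _ ↦ rfl }
  map_add' v w := by ext β; exact map_add β.1 v w
  map_smul' c v := by ext β; exact map_smul β.1 c v

/-- The `(0,1)`-component `α^{0,1} = (α + i α ∘ J) / 2` of a covector `α ∈ E_x^*`. -/
def part01 (x : M) : S.Estar x →ₗ[ℝ] S.Eform01 x where
  toFun α := ⟨(2⁻¹ : ℂ) • (Complex.ofRealCLM ∘L α.1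
      + Complex.I • (Complex.ofRealCLM ∘L α.1 ∘L S.J x)), by
    intro v
    have h1 : α.1 (S.J x (S.J x v)) = (-(α.1 v) : ℝ) := by
      have h2 : α.1 (S.ξ x) = (0 : ℝ) := α.2
      rw [S.J_J', map_add, map_smul, h2, smul_zero, add_zero, map_neg]
    simp only [smul_apply, add_apply, ContinuousLinearMap.comp_apply, h1, smul_eq_mul,
      Complex.ofRealCLM_apply, Complex.ofReal_neg]
    linear_combination ((2⁻¹ : ℂ) * (α.1 (S.J x v) : ℝ)) * Complex.I_mul_I⟩
  map_add' α β := by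
    ext v
    simp only [Submodule.coe_add, smul_apply, add_apply, ContinuousLinearMap.comp_apply,
      smul_eq_mul, Complex.ofRealCLM_apply, Complex.ofReal_add]
    ring
  map_smul' c α := by
    ext v
    simp only [Submodule.coe_smul, Submodule.coe_smul_of_tower, smul_apply, add_apply,
      ContinuousLinearMap.comp_apply, smul_eq_mul, Complex.ofRealCLM_apply, Complex.ofReal_mul,
      RingHom.id_apply, Complex.real_smul]
    ring

theorem part01_sharp (x : M) (α : S.Estar x) :
    S.evalAt x (S.sharp x α.1) (S.part01 x α) =
      ((2⁻¹ * S.g x (S.sharp x α.1) (S.sharp x α.1) : ℝ) : ℂ) := by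
  have h1 : (α.1 (S.sharp x α.1) : ℝ) = S.g x (S.sharp x α.1) (S.sharp x α.1) :=
    (S.g_sharp x α.1 _).symm
  have h2 : (α.1 (S.J x (S.sharp x α.1)) : ℝ) = 0 := by
    rw [← S.g_sharp x α.1, S.g_J_self]
  simp [evalAt, part01, h1, h2]

/-- The quadratic form `-|α|²` on `E_x^*`, where `|α|² = g_θ(α^♯, α^♯)` is the metric dual to
`g_θ` on `E`. -/
def Q (x : M) : QuadraticForm ℝ (S.Estar x) :=
  -((S.g x).toQuadraticMap.comp (S.sharp x ∘ₗ (S.Estar x).subtype))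

/-- The fibre of `Cl(E)`: the complexified Clifford algebra of `E_x^*`, with `α · α = -|α|²`. -/
abbrev Cl (x : M) : Type _ := ℂ ⊗[ℝ] CliffordAlgebra (S.Q x)

/-- The inclusion `E_x^* → Cl(E)_x`. -/
def ιCl (x : M) (α : S.Estar x) : S.Cl x := (1 : ℂ) ⊗ₜ[ℝ] CliffordAlgebra.ι (S.Q x) α

/-- The fibre of the spinor bundle `S = ∧ E^{0,1}`. -/
abbrev Spinor (x : M) : Type _ := ExteriorAlgebra ℂ (S.Eform01 x)

/-- The inclusion `E_x^{0,1} → S_x`. -/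
def ιS (x : M) (β : S.Eform01 x) : S.Spinor x := ExteriorAlgebra.ι ℂ β

/-- The Clifford action of `α ∈ E_x^*` on `S_x`: `c(α) = √2 (ε(α^{0,1}) - ι(α^{1,0}))`. The metric
identifies `α^{1,0}` with the `E_{0,1}`-component of `α^♯`; elements of `E^{0,1}` vanish on the
other components, so that the contraction with `α^{1,0}` is the contraction with `α^♯`. -/
def cliffordActionι (x : M) : S.Estar x →ₗ[ℝ] Module.End ℂ (S.Spinor x) where
  toFun α := ((√2 : ℝ) : ℂ) • (LinearMap.mulLeft ℂ (S.ιS x (S.part01 x α))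
    - CliffordAlgebra.contractLeft (S.evalAt x (S.sharp x α.1)))
  map_add' α β := by
    refine LinearMap.ext fun s ↦ ?_
    simp [ιS, add_mul, sub_eq_add_neg]
    abel
  map_smul' c α := by
    refine LinearMap.ext fun s ↦ ?_
    have h1 : S.ιS x (S.part01 x (c • α)) = (c : ℂ) • S.ιS x (S.part01 x α) := by
      have h : S.part01 x (c • α) = (c : ℂ) • S.part01 x α := by
        rw [map_smul]
        ext v
        exact (Complex.coe_smul c _).symm
      rw [h, ιS, map_smul, ιS]
    have h2 : S.evalAt x (S.sharp x (c • α).1) = (c : ℂ) • S.evalAt x (S.sharp x α.1) := by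
      rw [Submodule.coe_smul, map_smul, map_smul, Complex.coe_smul]
    rw [h1, h2]
    simp only [map_smul, smul_mul_assoc, LinearMap.smul_apply, LinearMap.sub_apply,
      LinearMap.mulLeft_apply, RingHom.id_apply]
    rw [← Complex.coe_smul c]
    module

theorem cliffordActionι_mul_self (x : M) (α : S.Estar x) :
    S.cliffordActionι x α * S.cliffordActionι x α =
      algebraMap ℝ (Module.End ℂ (S.Spinor x)) (S.Q x α) := by
  refine LinearMap.ext fun s ↦ ?_
  have h2 : ((√2 : ℝ) : ℂ) * ((√2 : ℝ) : ℂ) = 2 := by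
    rw [← Complex.ofReal_mul, Real.mul_self_sqrt (by norm_num)]
    norm_num
  have h3 : S.ιS x (S.part01 x α) * (S.ιS x (S.part01 x α) * s) = 0 := by
    rw [← mul_assoc, ιS, ExteriorAlgebra.ι_sq_zero, zero_mul]
  have h4 : CliffordAlgebra.contractLeft (S.evalAt x (S.sharp x α.1))
      (S.ιS x (S.part01 x α) * s)
      = ((2⁻¹ * S.g x (S.sharp x α.1) (S.sharp x α.1) : ℝ) : ℂ) • s - S.ιS x (S.part01 x α)
        * CliffordAlgebra.contractLeft (S.evalAt x (S.sharp x α.1)) s := by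
    rw [← S.part01_sharp]
    exact CliffordAlgebra.contractLeft_ι_mul _ _ _
  have h5 : S.Q x α = - S.g x (S.sharp x α.1) (S.sharp x α.1) := rfl
  simp only [cliffordActionι, LinearMap.coe_mk, AddHom.coe_mk, Module.End.mul_apply,
    LinearMap.smul_apply, LinearMap.sub_apply, LinearMap.mulLeft_apply, map_smul, map_sub,
    h3, h4, h5, CliffordAlgebra.contractLeft_contractLeft, Module.algebraMap_end_apply]
  rw [← Complex.coe_smul]
  push_cast
  match_scalars
  · linear_combination (-(S.g x (S.sharp x α.1) (S.sharp x α.1) : ℂ) / 2) * h2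
  · ring

/-- The Clifford action `c : Cl(E)_x → End(S_x)`, a homomorphism of complex algebras. -/
def cliffordAction (x : M) : S.Cl x →ₐ[ℂ] Module.End ℂ (S.Spinor x) :=
  Algebra.TensorProduct.lift (Algebra.ofId ℂ _)
    (CliffordAlgebra.lift (S.Q x) ⟨S.cliffordActionι x, S.cliffordActionι_mul_self x⟩)
    (fun c _ ↦ Algebra.commutes c _)

/-! ### Smooth sections and induced connections -/

section LocalExpressions

variable {A V : M → Type*} [∀ x, Ring (A x)] [∀ x, Algebra ℂ (A x)]

/-- A formal finite sum of products `f · α₁ ⋯ α_r` of a complex function `f` on `M` and sections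
`α₁, …, α_r` of a bundle `V`. -/
abbrev Expr (V : M → Type*) : Type _ := List ((M → ℂ) × List (Π x : M, V x))

/-- The product `α₁ ⋯ α_r` at the point `x`, in the algebra `A x` generated by `V x`. -/
def wordVal (ι : Π x, V x → A x) (l : List (Π x : M, V x)) (x : M) : A x :=
  (l.map fun α ↦ ι x (α x)).prod

/-- The value of an expression at the point `x`. -/
def exprVal (ι : Π x, V x → A x) (e : Expr V) (x : M) : A x :=
  (e.map fun t ↦ t.1 x • wordVal ι t.2 x).sum

/-- The Leibniz rule `∑ⱼ α₁ ⋯ (D αⱼ) ⋯ α_r` at the point `x`, where `D α ∈ V x` is the derivative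
of the section `α` at `x`. -/
def wordDeriv (ι : Π x, V x → A x) (x : M) (D : (Π x : M, V x) → V x) :
    List (Π x : M, V x) → A x
  | [] => 0
  | α :: l => ι x (D α) * wordVal ι l x + ι x (α x) * wordDeriv ι x D l

/-- The Leibniz rule `∑ (v f) α₁ ⋯ α_r + f ∑ⱼ α₁ ⋯ (D αⱼ) ⋯ α_r` for an expression. -/
def exprDeriv (ι : Π x, V x → A x) (x : M) (v : TangentSpace I x) (D : (Π x : M, V x) → V x)
    (e : Expr V) : A x :=
  (e.map fun t ↦ mvfderiv I t.1 x v • wordVal ι t.2 x + t.1 x • wordDeriv ι x D t.2).sum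

/-- `e` is an expression in smooth functions and smooth sections of `V` for the section `s` of `A`
on a neighbourhood of `x`. -/
def IsLocalExpr (I : ModelWithCorners ℝ F H) (ι : Π x, V x → A x)
    (smoothV : (Π x : M, V x) → Prop) (s : Π x : M, A x) (x : M) (e : Expr V) : Prop :=
  (∀ t ∈ e, ContMDiff I 𝓘(ℝ, ℂ) ∞ t.1 ∧ ∀ α ∈ t.2, smoothV α) ∧
    ∀ᶠ y in 𝓝 x, s y = exprVal ι e y

/-- The section `s` of the bundle of algebras `A` generated by `V` is smooth: near every point, it is
a finite sum of products of smooth functions and smooth sections of `V`. -/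
def IsSmoothSection (I : ModelWithCorners ℝ F H) (ι : Π x, V x → A x)
    (smoothV : (Π x : M, V x) → Prop) (s : Π x : M, A x) : Prop :=
  ∀ x, ∃ e, IsLocalExpr I ι smoothV s x e

/-- The connection on `A` induced by a connection `D` on the generating bundle `V`, that is, the
extension of `D` by the Leibniz rule: its value is computed from an expression of the section
near the point as a sum of products of smooth functions and smooth sections of `V`. The expression
is chosen once for each section and point. For the two bundles below, the value does not depend on
it: for `∧ E^{0,1}` always, and for `Cl(E)` because `D` preserves the metric and hence the Clifford
relations. -/
def inducedConnection (ι : Π x, V x → A x) (smoothV : (Π x : M, V x) → Prop)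
    (D : (Π x : M, V x) → Π x : M, TangentSpace I x → V x)
    (s : Π x : M, A x) (x : M) (v : TangentSpace I x) : A x :=
  open Classical in
  if h : ∃ e, IsLocalExpr I ι smoothV s x e
  then exprDeriv ι x v (fun α ↦ D α x v) h.choose else 0

end LocalExpressions

section Induced

variable {S} {cov : CovariantDerivative I F (TangentSpace I : M → Type _)}

theorem IsTanakaWebster.cov_ξ (h : S.IsTanakaWebster cov) (x : M) (v : TangentSpace I x) :
    cov S.ξ x v = 0 := by
  have hξ : MDiffAt (T% S.ξ) x := S.smooth_ξ.mdifferentiable (by simp) x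
  refine (S.g_nondegenerate x).1 _ fun w ↦ ?_
  have hw : MDiffAt (T% (FiberBundle.extend F w)) x :=
    FiberBundle.mdifferentiableAt_extend ..
  have h1 := h.parallel_g S.ξ (FiberBundle.extend F w) x hξ hw v
  simp only [θ_apply_eq] at h1
  rw [h.parallel_θ _ x hw v] at h1
  simpa using h1

theorem IsTanakaWebster.covForm_mem_Estar (h : S.IsTanakaWebster cov)
    (α : Π x : M, S.Estar x) (x : M) (v : TangentSpace I x) :
    covForm cov (fun y ↦ (α y).1) x v ∈ S.Estar x := by
  by_cases hα : SmoothForm (fun y ↦ (α y).1)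
  · have hξ : MDiffAt (T% S.ξ) x := S.smooth_ξ.mdifferentiable (by simp) x
    have h0 : (fun y ↦ ((α y).1 (S.ξ y) : ℝ)) = fun _ ↦ 0 := funext fun y ↦ (α y).2
    change (covForm cov (fun y ↦ (α y).1) x v (S.ξ x) : ℝ) = 0
    rw [covForm_apply cov hα v hξ, h0, h.cov_ξ]
    have h1 : mvfderiv I (fun _ : M ↦ (0 : ℝ)) x = 0 := mvfderiv_const 0
    simp [h1]
  · rw [covForm, dif_neg hα]
    exact zero_mem _

theorem IsTanakaWebster.covForm_mem_Eform01 (h : S.IsTanakaWebster cov)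
    (β : Π x : M, S.Eform01 x) (x : M) (v : TangentSpace I x) :
    covForm cov (fun y ↦ (β y).1) x v ∈ S.Eform01 x := by
  by_cases hβ : SmoothForm (fun y ↦ (β y).1)
  · intro w
    have hw : MDiffAt (T% (FiberBundle.extend F w)) x :=
    FiberBundle.mdifferentiableAt_extend ..
    have h1 := covForm_apply cov hβ v hw
    have h2 := covForm_apply cov hβ v (S.smooth_J.mdifferentiableAt_apply hw)
    have h0 : (fun y ↦ ((β y).1 (S.J y (FiberBundle.extend F w y)) : ℂ)) =
        fun y ↦ -Complex.I • ((β y).1 (FiberBundle.extend F w y) : ℂ) :=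
      funext fun y ↦ (β y).2 _
    have h3 := (β x).2 (cov (FiberBundle.extend F w) x v)
    have h4 := mvfderiv_clm_apply ((-Complex.I) • ContinuousLinearMap.id ℝ ℂ)
      (hβ.mdifferentiableAt_apply hw) v
    simp only [smul_apply, ContinuousLinearMap.id_apply] at h4
    rw [h0, h.parallel_J _ x hw, h3, h4] at h2
    simp only [FiberBundle.extend_apply_self] at h1 h2
    rw [h2, h1, mul_sub, smul_eq_mul]
  · rw [covForm, dif_neg hβ]
    exact zero_mem _

/-- The connection on `E^*` induced by the Tanaka-Webster connection. -/
def covEstar (h : S.IsTanakaWebster cov) (α : Π x : M, S.Estar x) (x : M)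
    (v : TangentSpace I x) : S.Estar x :=
  ⟨covForm cov (fun y ↦ (α y).1) x v, h.covForm_mem_Estar α x v⟩

/-- The connection on `E^{0,1}` induced by the Tanaka-Webster connection. -/
def covEform01 (h : S.IsTanakaWebster cov) (β : Π x : M, S.Eform01 x) (x : M)
    (v : TangentSpace I x) : S.Eform01 x :=
  ⟨covForm cov (fun y ↦ (β y).1) x v, h.covForm_mem_Eform01 β x v⟩

/-- Smooth sections of `Cl(E)`. -/
def SmoothCl (S : PseudohermitianStructure I M) (a : Π x : M, S.Cl x) : Prop :=
  IsSmoothSection I S.ιCl (fun α ↦ SmoothForm fun x ↦ (α x).1) a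

/-- Smooth sections of `S = ∧ E^{0,1}`. -/
def SmoothSpinor (S : PseudohermitianStructure I M) (s : Π x : M, S.Spinor x) : Prop :=
  IsSmoothSection I S.ιS (fun β ↦ SmoothForm fun x ↦ (β x).1) s

/-- The connection on `Cl(E)` induced by the Tanaka-Webster connection. -/
def covCl (h : S.IsTanakaWebster cov) (a : Π x : M, S.Cl x) (x : M) (v : TangentSpace I x) :
    S.Cl x :=
  inducedConnection S.ιCl (fun α ↦ SmoothForm fun x ↦ (α x).1) (covEstar h) a x v

/-- The connection on `S = ∧ E^{0,1}` induced by the Tanaka-Webster connection. -/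
def covSpinor (h : S.IsTanakaWebster cov) (s : Π x : M, S.Spinor x) (x : M)
    (v : TangentSpace I x) : S.Spinor x :=
  inducedConnection S.ιS (fun β ↦ SmoothForm fun x ↦ (β x).1) (covEform01 h) s x v

/-- `nabla` is a connection on the complex vector bundle `S = ∧ E^{0,1}`. -/
structure IsSpinorConnection (S : PseudohermitianStructure I M)
    (nabla : (Π x : M, S.Spinor x) → Π x : M, TangentSpace I x → S.Spinor x) : Prop where
  smooth : ∀ (s : Π x : M, S.Spinor x) (X : Π x : M, TangentSpace I x), S.SmoothSpinor s →
    SmoothField I X → S.SmoothSpinor (fun x ↦ nabla s x (X x))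
  map_add : ∀ s x v w, S.SmoothSpinor s → nabla s x (v + w) = nabla s x v + nabla s x w
  map_smul : ∀ s x v (c : ℝ), S.SmoothSpinor s → nabla s x (c • v) = (c : ℂ) • nabla s x v
  add : ∀ s t x v, S.SmoothSpinor s → S.SmoothSpinor t →
    nabla (fun y ↦ s y + t y) x v = nabla s x v + nabla t x v
  leibniz : ∀ (f : M → ℂ) (s : Π x : M, S.Spinor x) x v, ContMDiff I 𝓘(ℝ, ℂ) ∞ f →
    S.SmoothSpinor s →
    nabla (fun y ↦ f y • s y) x v = mvfderiv I f x v • s x + f x • nabla s x v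

/-- `nabla` is a CR-Clifford connection on the Clifford module `S = ∧ E^{0,1}`: it is a connection,
and `[∇_X, c(a)] = c(∇^{TW}_X a)` on smooth sections of `S`, for all smooth sections `a` of `Cl(E)`
and all vector fields `X`. -/
structure IsCRCliffordConnection (h : S.IsTanakaWebster cov)
    (nabla : (Π x : M, S.Spinor x) → Π x : M, TangentSpace I x → S.Spinor x) : Prop where
  isConnection : S.IsSpinorConnection nabla
  action_smooth : ∀ a s, S.SmoothCl a → S.SmoothSpinor s →
    S.SmoothSpinor (fun y ↦ S.cliffordAction y (a y) (s y))
  commutator : ∀ (a : Π x : M, S.Cl x) (X : Π x : M, TangentSpace I x), S.SmoothCl a →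
    SmoothField I X → ∀ s : Π x : M, S.Spinor x, S.SmoothSpinor s → ∀ x,
    nabla (fun y ↦ S.cliffordAction y (a y) (s y)) x (X x)
        - S.cliffordAction x (a x) (nabla s x (X x))
      = S.cliffordAction x (covCl h a x (X x)) (s x)

end Induced

end PseudohermitianStructure

end CRClifford
end

/-!
The spinor connection and the connection on `Cl(E)` are both computed from local expressions, finite
sums of products `f · α₁ ⋯ α_r`, by the Leibniz rule. The proof has three ingredients.

*The spinor connection does not depend on the expression.* Contracting an expression in sections of
`E^{0,1}` with a smooth vector field `Y` gives an expression with shorter words, and contraction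
commutes with the Leibniz derivative up to the contraction with `∇ Y` (`exprDeriv_contrExpr`). Hence,
if the value of an expression vanishes near a point, then, by induction on the length of its words,
all contractions of its derivative vanish at this point, and so does the scalar part, which is the
derivative of a function that is zero. Over a field of characteristic zero such an element of an
exterior algebra is zero (`exteriorAlgebra_eq_zero`), because the Euler operator `∑ bᵢ ∧ ι(bⁱ)`
multiplies the elements of degree `r` by `r`. This is `exprDeriv_eq_zero`, and `covSpinor_eq` follows:
`∇` may be computed from any local expression. Additivity and the Leibniz rules with respect to
functions, left multiplication by sections of `E^{0,1}` and contraction with vector fields are then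
immediate.

*The Clifford action of covectors is parallel.* The metric and `J` are parallel, so that
`∇ (α^♯) = (∇ α)^♯` and `∇ (α^{0,1}) = (∇ α)^{0,1}`. With the Leibniz rules above this gives
`∇ (c(α) s) = c(∇ α) s + c(α) ∇ s` (`covSpinor_cliffordAction_ιCl`). By induction on words the same
identity holds for every expression in sections of `E^*`, whence the commutator formula. No
independence of the connection on `Cl(E)` from the expression is needed here.

*Smoothness.* A one-form is smooth when its values on smooth vector fields are smooth, and `α^♯`
solves a linear system given by the Gram matrix of a local frame, so that it is smooth by Cramer's
rule (`smoothField_sharp`).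
-/

noncomputable section

namespace CRClifford

/-! ### Products of complex functions on a manifold -/

section ComplexFunctions

variable {F : Type*} [NormedAddCommGroup F] [NormedSpace ℝ F]
  {H : Type*} [TopologicalSpace H] {I : ModelWithCorners ℝ F H}
  {M : Type*} [TopologicalSpace M] [ChartedSpace H M]

theorem contMDiff_complex_mul {f g : M → ℂ} (hf : ContMDiff I 𝓘(ℝ, ℂ) ∞ f)
    (hg : ContMDiff I 𝓘(ℝ, ℂ) ∞ g) : ContMDiff I 𝓘(ℝ, ℂ) ∞ (fun y ↦ f y * g y) :=
  (contDiff_mul (𝕜 := ℝ) (𝔸 := ℂ)).contMDiff.comp (hf.prodMk_space hg)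

theorem mvfderiv_complex_mul {f g : M → ℂ} {x : M} (hf : MDifferentiableAt I 𝓘(ℝ, ℂ) f x)
    (hg : MDifferentiableAt I 𝓘(ℝ, ℂ) g x) (v : TangentSpace I x) :
    mvfderiv I (fun y ↦ f y * g y) x v = f x * mvfderiv I g x v + g x * mvfderiv I f x v := by
  have h := (hf.hasMFDerivAt.mul hg.hasMFDerivAt).mfderiv
  change mfderiv I 𝓘(ℝ, ℂ) (f * g) x v = _
  rw [h]
  rfl

theorem mvfderiv_apply_congr {W : Type*} [NormedAddCommGroup W] [NormedSpace ℝ W] {f g : M → W}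
    {x : M} (h : f =ᶠ[𝓝 x] g) (v : TangentSpace I x) : mvfderiv I f x v = mvfderiv I g x v := by
  change (mfderiv I 𝓘(ℝ, W) f x v : W) = (mfderiv I 𝓘(ℝ, W) g x v : W)
  rw [h.mfderiv_eq]
  rfl

end ComplexFunctions

/-! ### Smoothness tested on vector fields -/

section SmoothnessCriteria

variable {F : Type*} [NormedAddCommGroup F] [NormedSpace ℝ F]
  {H : Type*} [TopologicalSpace H] {I : ModelWithCorners ℝ F H}
  {M : Type*} [TopologicalSpace M] [ChartedSpace H M] [IsManifold I ∞ M]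
  {W : Type*} [NormedAddCommGroup W] [NormedSpace ℝ W]

theorem SmoothField.mdifferentiableAt {X : Π x : M, TangentSpace I x} (hX : SmoothField I X)
    (x : M) : MDiffAt (T% X) x :=
  ContMDiff.mdifferentiable hX (by simp) x

theorem SmoothForm.contMDiff_apply {α : Π x : M, Form I W x} (hα : SmoothForm α)
    {Y : Π x : M, TangentSpace I x} (hY : SmoothField I Y) :
    ContMDiff I 𝓘(ℝ, W) ∞ (fun y ↦ (α y (Y y) : W)) := by
  intro x
  have := ContMDiffAt.clm_bundle_apply (F₁ := F) (F₂ := W) (b := fun x : M => x)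
    (E₁ := (TangentSpace I : M → Type _)) (E₂ := Trivial M W) (ϕ := α) (v := Y) (IB := I)
    (hα x) (hY x)
  simpa [contMDiffAt_section] using this

theorem SmoothEnd.smoothField_apply {A : Π x : M, TangentSpace I x →L[ℝ] TangentSpace I x}
    (hA : SmoothEnd A) {Y : Π x : M, TangentSpace I x} (hY : SmoothField I Y) :
    SmoothField I (fun y ↦ A y (Y y)) :=
  ContMDiff.clm_bundle_apply (F₁ := F) (F₂ := F) (b := fun x : M => x)
    (E₁ := (TangentSpace I : M → Type _)) (E₂ := (TangentSpace I : M → Type _))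
    (ϕ := A) (v := Y) (IB := I) hA hY

theorem contMDiff_mvfderiv_apply {f : M → W} (hf : ContMDiff I 𝓘(ℝ, W) ∞ f)
    {X : Π x : M, TangentSpace I x} (hX : SmoothField I X) :
    ContMDiff I 𝓘(ℝ, W) ∞ (fun y ↦ mvfderiv I f y (X y)) := by
  have h1 : ContMDiff I.tangent 𝓘(ℝ, W).tangent ∞ (tangentMap I 𝓘(ℝ, W) f) :=
    hf.contMDiff_tangentMap (by simp)
  exact contMDiff_snd_tangentBundle_modelSpace (E := W) (H := W) (I := 𝓘(ℝ, W)) |>.comp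
    (h1.comp hX)

theorem SmoothField.mlieBracket [CompleteSpace F] {X Y : Π x : M, TangentSpace I x}
    (hX : SmoothField I X) (hY : SmoothField I Y) : SmoothField I (mlieBracket I X Y) := by
  have : IsManifold I (minSmoothness ℝ 2) M := by
    rw [minSmoothness_of_isRCLikeNormedField]
    infer_instance
  have : IsManifold I (((⊤ : ℕ∞) : WithTop ℕ∞) + 1) M := inferInstanceAs (IsManifold I ∞ M)
  intro x
  exact ContMDiffAt.mlieBracket_vectorField (m := ⊤) (n := ⊤) (hX x) (hY x) (by simp)

variable [FiniteDimensional ℝ F] [T2Space M]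

/-- Around every point the tangent bundle has a frame made of globally smooth vector fields. -/
theorem exists_smoothField_eq_localFrame {ι : Type*} (b : Module.Basis ι ℝ F) (x₀ : M) :
    ∃ Y : ι → Π x : M, TangentSpace I x, (∀ i, SmoothField I (Y i)) ∧
      ∀ᶠ x in 𝓝 x₀, ∀ i,
        Y i x = (trivializationAt F (TangentSpace I : M → Type _) x₀).localFrame b i x := by
  set e := trivializationAt F (TangentSpace I : M → Type _) x₀
  let ψ : SmoothBumpFunction I x₀ := Classical.choice inferInstance
  refine ⟨fun i x ↦ ψ x • e.localFrame b i x, fun i ↦ ?_, ?_⟩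
  · refine ContMDiffOn.smul_section_of_tsupport (s := e.localFrame b i) ψ.contMDiff.contMDiffOn
      e.open_baseSet ?_ (e.contMDiffOn_localFrame_baseSet ∞ b i)
    exact ψ.tsupport_subset_chartAt_source
  · filter_upwards [ψ.eventuallyEq_one] with x hx i
    simp [hx, e]

theorem exists_smoothField_apply_eq {x₀ : M} (w : TangentSpace I x₀) :
    ∃ Y : Π x : M, TangentSpace I x, SmoothField I Y ∧ Y x₀ = w := by
  let b := Module.finBasis ℝ F
  obtain ⟨Y, hY, hYe⟩ := exists_smoothField_eq_localFrame (I := I) b x₀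
  let B := (trivializationAt F (TangentSpace I : M → Type _) x₀).basisAt b
    (FiberBundle.mem_baseSet_trivializationAt' x₀)
  refine ⟨fun x ↦ ∑ i, B.repr w i • Y i x,
    ContMDiff.sum_section fun i _ ↦ contMDiff_const.smul_section (hY i), ?_⟩
  have h1 : ∀ i, Y i x₀ = B i := fun i ↦ by
    rw [hYe.self_of_nhds i, Trivialization.localFrame_apply_of_mem_baseSet]
  simp only [h1]
  exact B.sum_repr w

/-- A one-form is smooth if its values on smooth vector fields are smooth functions. -/
theorem smoothForm_of_apply {α : Π x : M, Form I W x}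
    (h : ∀ Y : Π x : M, TangentSpace I x, SmoothField I Y →
      ContMDiff I 𝓘(ℝ, W) ∞ (fun y ↦ (α y (Y y) : W))) : SmoothForm α := by
  intro x₀
  let b := Module.finBasis ℝ F
  obtain ⟨Y, hY, hYe⟩ := exists_smoothField_eq_localFrame (I := I) b x₀
  refine (contMDiffAt_hom_bundle (E₁ := (TangentSpace I : M → Type _)) (E₂ := Trivial M W) _).2
    ⟨contMDiffAt_id, ?_⟩
  have h2 : ContMDiffAt I 𝓘(ℝ, F →L[ℝ] W) ∞ (fun x ↦ ∑ i,
      ContinuousLinearMap.smulRightL ℝ F W (b.coord i).toContinuousLinearMap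
        (α x (Y i x) : W)) x₀ := by
    refine ContMDiffAt.sum fun i _ ↦ ?_
    exact ContMDiffAt.comp x₀ (ContinuousLinearMap.contMDiff _).contMDiffAt (h _ (hY i) x₀)
  refine h2.congr_of_eventuallyEq ?_
  filter_upwards [hYe, (trivializationAt F (TangentSpace I : M → Type _) x₀).open_baseSet.mem_nhds
    (FiberBundle.mem_baseSet_trivializationAt' x₀)] with x hx hxe
  refine ContinuousLinearMap.coe_injective (b.ext fun j ↦ ?_)
  have h3 := Trivialization.localFrame_apply_of_mem_baseSet
    (trivializationAt F (TangentSpace I : M → Type _) x₀) b (i := j) hxe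
  simp [ContinuousLinearMap.inCoordinates, hx, Finsupp.single_apply, ite_smul, h3,
    Trivialization.basisAt]
  exact congrArg (α x) (Trivialization.symmL_apply _ hxe _)

end SmoothnessCriteria

/-! ### Smooth dependence of solutions of linear systems -/

section GramSystems

variable {F : Type*} [NormedAddCommGroup F] [NormedSpace ℝ F]
  {H : Type*} [TopologicalSpace H] {I : ModelWithCorners ℝ F H}
  {M : Type*} [TopologicalSpace M] [ChartedSpace H M]

theorem contMDiffAt_matrix_det {ι : Type*} [Fintype ι] [DecidableEq ι] {k : WithTop ℕ∞}
    {G : M → Matrix ι ι ℝ} {x : M}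
    (hG : ∀ i j, ContMDiffAt I 𝓘(ℝ, ℝ) k (fun y ↦ G y i j) x) :
    ContMDiffAt I 𝓘(ℝ, ℝ) k (fun y ↦ (G y).det) x := by
  simp only [Matrix.det_apply']
  exact ContMDiffAt.sum fun σ _ ↦ contMDiffAt_const.mul
    (ContMDiffAt.prod fun i _ ↦ hG _ _)

/-- The solution of a linear system depends smoothly on its data, by Cramer's rule. -/
theorem contMDiffAt_of_mulVec_eq {ι : Type*} [Fintype ι] [DecidableEq ι] {k : WithTop ℕ∞}
    {G : M → Matrix ι ι ℝ} {a c : M → ι → ℝ} {x : M}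
    (hG : ∀ i j, ContMDiffAt I 𝓘(ℝ, ℝ) k (fun y ↦ G y i j) x)
    (ha : ∀ i, ContMDiffAt I 𝓘(ℝ, ℝ) k (fun y ↦ a y i) x)
    (hdet : ∀ᶠ y in 𝓝 x, (G y).det ≠ 0)
    (hc : ∀ᶠ y in 𝓝 x, (G y).mulVec (c y) = a y) (i : ι) :
    ContMDiffAt I 𝓘(ℝ, ℝ) k (fun y ↦ c y i) x := by
  have h1 : ContMDiffAt I 𝓘(ℝ, ℝ) k
      (fun y ↦ (G y).det⁻¹ * ((G y).updateCol i (a y)).det) x := by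
    refine ContMDiffAt.mul ?_ (contMDiffAt_matrix_det fun j l ↦ ?_)
    · exact (contMDiffAt_matrix_det hG).inv₀ hdet.self_of_nhds
    · by_cases hl : l = i
      · subst hl
        simpa using ha j
      · simpa [Matrix.updateCol_ne hl] using hG j l
  refine h1.congr_of_eventuallyEq ?_
  filter_upwards [hdet, hc] with y hy hcy
  have h2 : (G y).cramer (a y) = (G y).det • c y := by
    rw [← hcy, Matrix.cramer_eq_adjugate_mulVec, Matrix.mulVec_mulVec, Matrix.adjugate_mul,
      Matrix.smul_mulVec, Matrix.one_mulVec]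
  have h3 := congrFun h2 i
  rw [Matrix.cramer_apply, Pi.smul_apply, smul_eq_mul] at h3
  rw [h3, inv_mul_cancel_left₀ hy]

end GramSystems

namespace PseudohermitianStructure

/-! ### Smoothness of the metric, the connection and the induced forms -/

section Parallel

variable {F : Type*} [NormedAddCommGroup F] [NormedSpace ℝ F]
  [CompleteSpace F] [FiniteDimensional ℝ F] {H : Type*} [TopologicalSpace H]
  {I : ModelWithCorners ℝ F H} {M : Type*} [TopologicalSpace M] [ChartedSpace H M]
  [IsManifold I ∞ M] (S : PseudohermitianStructure I M)

theorem contMDiff_g_apply {X Y : Π x : M, TangentSpace I x} (hX : SmoothField I X)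
    (hY : SmoothField I Y) : ContMDiff I 𝓘(ℝ, ℝ) ∞ (fun y ↦ S.g y (X y) (Y y)) := by
  have hJY := S.smooth_J.smoothField_apply hY
  have h1 : ContMDiff I 𝓘(ℝ, ℝ) ∞ (fun y ↦ extDerivFun S.θ y X (fun y ↦ S.J y (Y y))) := by
    unfold extDerivFun
    exact contMDiff_const.mul (((contMDiff_mvfderiv_apply (S.smooth_θ.contMDiff_apply hJY) hX).sub
      (contMDiff_mvfderiv_apply (S.smooth_θ.contMDiff_apply hX) hJY)).sub
      (S.smooth_θ.contMDiff_apply (hX.mlieBracket hJY)))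
  refine (h1.neg.add ((S.smooth_θ.contMDiff_apply hX).mul
    (S.smooth_θ.contMDiff_apply hY))).congr fun y ↦ ?_
  have h2 : extDeriv S.θ S.smooth_θ y (X y) (S.J y (Y y))
      = extDerivFun S.θ y X (fun y ↦ S.J y (Y y)) :=
    TensorialAt.mkHom₂_apply _ _ (hX.mdifferentiableAt y) (hJY.mdifferentiableAt y)
  simp [g, websterForm, h2]

/-- In a local frame `α^♯` solves the linear system whose matrix is the Gram matrix of the frame. -/
theorem smoothField_sharp [T2Space M] {α : Π x : M, Form I ℝ x} (hα : SmoothForm α) :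
    SmoothField I (fun x ↦ S.sharp x (α x)) := by
  intro x₀
  let b := Module.finBasis ℝ F
  let e := trivializationAt F (TangentSpace I : M → Type _) x₀
  obtain ⟨Y, hY, hYe⟩ : ∃ Y : _ → Π x : M, TangentSpace I x, (∀ i, SmoothField I (Y i)) ∧
      ∀ᶠ x in 𝓝 x₀, ∀ i, Y i x = e.localFrame b i x := exists_smoothField_eq_localFrame b x₀
  have hx₀ : x₀ ∈ e.baseSet := FiberBundle.mem_baseSet_trivializationAt' x₀
  have hbase := e.open_baseSet.mem_nhds hx₀
  refine (e.isLocalFrameOn_localFrame_baseSet I ∞ b).contMDiffAt_of_coeff (fun i ↦ ?_) hbase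
  refine contMDiffAt_of_mulVec_eq (G := fun y ↦ Matrix.of fun i j ↦ S.g y (Y i y) (Y j y))
    (a := fun y i ↦ (α y (Y i y) : ℝ))
    (c := fun y i ↦ (e.isLocalFrameOn_localFrame_baseSet I ∞ b).coeff i y (S.sharp y (α y)))
    (fun i j ↦ S.contMDiff_g_apply (hY i) (hY j) x₀)
    (fun i ↦ hα.contMDiff_apply (hY i) x₀) ?_ ?_ i
  · filter_upwards [hYe, hbase] with y hy hye
    have h1 : (Matrix.of fun i j ↦ S.g y (Y i y) (Y j y))
        = LinearMap.BilinForm.toMatrix (e.basisAt b hye) (S.g y) := by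
      ext i j
      simp [hy, hye, LinearMap.BilinForm.toMatrix_apply]
    rw [h1]
    exact (LinearMap.BilinForm.nondegenerate_iff_det_ne_zero _).1 (S.g_nondegenerate y)
  · filter_upwards [hYe, hbase] with y hy hye
    ext i
    have h1 := (e.isLocalFrameOn_localFrame_baseSet I ∞ b).coeff_sum_eq
      (fun y ↦ S.sharp y (α y)) hye
    have h2 : S.g y (Y i y) (S.sharp y (α y)) = (α y (Y i y) : ℝ) := by
      rw [← S.g_sharp]
      exact S.webster_symm y _ _
    rw [← h2]
    conv_rhs => rw [h1]
    simp [Matrix.mulVec, dotProduct, hy, mul_comm]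

variable {S} {cov : CovariantDerivative I F (TangentSpace I : M → Type _)}

theorem IsTanakaWebster.smoothField_cov (h : S.IsTanakaWebster cov)
    {X Y : Π x : M, TangentSpace I x} (hX : SmoothField I X) (hY : SmoothField I Y) :
    SmoothField I (fun x ↦ cov Y x (X x)) := by
  have h1 := h.smooth.contMDiff.contMDiff (σ := Y) (by
    simpa using ContMDiff.contMDiffOn hY)
  exact SmoothEnd.smoothField_apply (contMDiffOn_univ.1 h1) hX

variable [T2Space M]

theorem IsTanakaWebster.smoothForm_covForm (h : S.IsTanakaWebster cov)
    {W : Type*} [NormedAddCommGroup W] [NormedSpace ℝ W] {α : Π x : M, Form I W x}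
    (hα : SmoothForm α) {X : Π x : M, TangentSpace I x} (hX : SmoothField I X) :
    SmoothForm (fun x ↦ covForm cov α x (X x)) := by
  refine smoothForm_of_apply fun Y hY ↦ ?_
  refine ((contMDiff_mvfderiv_apply (hα.contMDiff_apply hY) hX).sub
    (hα.contMDiff_apply (h.smoothField_cov hX hY))).congr fun y ↦ ?_
  exact covForm_apply cov hα _ (hY.mdifferentiableAt y)

theorem smoothForm_part01 {α : Π x : M, S.Estar x} (hα : SmoothForm fun x ↦ (α x).1) :
    SmoothForm (fun x ↦ (S.part01 x (α x)).1) := by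
  refine smoothForm_of_apply fun Y hY ↦ ?_
  have h1 : ∀ {f : M → ℝ}, ContMDiff I 𝓘(ℝ, ℝ) ∞ f →
      ContMDiff I 𝓘(ℝ, ℂ) ∞ (fun y ↦ ((f y : ℝ) : ℂ)) := fun hf ↦
    Complex.ofRealCLM.contMDiff.comp hf
  exact contMDiff_complex_mul contMDiff_const ((h1 (hα.contMDiff_apply hY)).add
    (contMDiff_complex_mul contMDiff_const
      (h1 (hα.contMDiff_apply (S.smooth_J.smoothField_apply hY)))))

/-! ### Covariant derivatives of the musical isomorphism and of the type decomposition -/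

/-- `∇ (α^♯) = (∇ α)^♯`, because the metric is parallel. -/
theorem IsTanakaWebster.cov_sharp (h : S.IsTanakaWebster cov) {α : Π x : M, Form I ℝ x}
    (hα : SmoothForm α) (x : M) (v : TangentSpace I x) :
    cov (fun y ↦ S.sharp y (α y)) x v = S.sharp x (covForm cov α x v) := by
  have hα' := (S.smoothField_sharp hα).mdifferentiableAt x
  rw [← sub_eq_zero]
  refine (S.g_nondegenerate x).1 _ fun w ↦ ?_
  have hw : MDiffAt (T% (FiberBundle.extend F w)) x :=
    FiberBundle.mdifferentiableAt_extend ..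
  have h1 := h.parallel_g _ _ x hα' hw v
  have h2 := covForm_apply cov hα v hw
  simp only [g_sharp] at h1
  simp only [FiberBundle.extend_apply_self] at h1 h2
  rw [map_sub, LinearMap.sub_apply, g_sharp, h2, h1]
  ring

/-- `∇ (α^{0,1}) = (∇ α)^{0,1}`, because `J` is parallel. -/
theorem IsTanakaWebster.covEform01_part01 (h : S.IsTanakaWebster cov) {α : Π x : M, S.Estar x}
    (hα : SmoothForm fun x ↦ (α x).1) (x : M) (v : TangentSpace I x) :
    covEform01 h (fun y ↦ S.part01 y (α y)) x v = S.part01 x (covEstar h α x v) := by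
  ext w
  have hw : MDiffAt (T% (FiberBundle.extend F w)) x :=
    FiberBundle.mdifferentiableAt_extend ..
  have hJw := S.smooth_J.mdifferentiableAt_apply hw
  have h1 := covForm_apply cov (smoothForm_part01 hα) v hw
  have h2 := covForm_apply cov hα v hw
  have h3 := covForm_apply cov hα v hJw
  have h4 := hα.mdifferentiableAt_apply hw
  have h5 := hα.mdifferentiableAt_apply hJw
  have h6 : mvfderiv I (fun y ↦ ((S.part01 y (α y)).1 (FiberBundle.extend F w y) : ℂ)) x v
      = (2⁻¹ : ℂ) * ((mvfderiv I (fun y ↦ ((α y).1 (FiberBundle.extend F w y) : ℝ)) x v : ℝ)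
        + Complex.I *
          (mvfderiv I (fun y ↦ ((α y).1 (S.J y (FiberBundle.extend F w y)) : ℝ)) x v : ℝ)) := by
    let L : ℝ →L[ℝ] ℂ := (2⁻¹ : ℂ) • Complex.ofRealCLM
    let L' : ℝ →L[ℝ] ℂ := (2⁻¹ * Complex.I) • Complex.ofRealCLM
    have h7 : (fun y ↦ ((S.part01 y (α y)).1 (FiberBundle.extend F w y) : ℂ)) = fun y ↦
        L ((α y).1 (FiberBundle.extend F w y)) + L' ((α y).1 (S.J y (FiberBundle.extend F w y))) := by
      ext y
      change (2⁻¹ : ℂ) * ((((α y).1 _ : ℝ) : ℂ) + Complex.I * ((α y).1 _ : ℝ))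
        = (2⁻¹ : ℂ) * _ + (2⁻¹ * Complex.I) * _
      rw [mul_add, mul_assoc]
      rfl
    have h8 := mvfderiv_fun_add (I := I)
      (g := fun y ↦ L ((α y).1 (FiberBundle.extend F w y)))
      (g' := fun y ↦ L' ((α y).1 (S.J y (FiberBundle.extend F w y))))
      (L.mdifferentiableAt.comp x h4) (L'.mdifferentiableAt.comp x h5)
    rw [h7, h8, add_apply, mvfderiv_clm_apply L h4, mvfderiv_clm_apply L' h5, mul_add,
      ← mul_assoc]
    rfl
  rw [h.parallel_J _ x hw] at h3
  simp only [FiberBundle.extend_apply_self] at h1 h2 h3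
  change (covForm cov (fun y ↦ (S.part01 y (α y)).1) x v w : ℂ) = (2⁻¹ : ℂ) *
    (((covForm cov (fun y ↦ (α y).1) x v w : ℝ) : ℂ)
      + Complex.I * (covForm cov (fun y ↦ (α y).1) x v (S.J x w) : ℝ))
  rw [h1, h2, h3, h6]
  change _ - (2⁻¹ : ℂ) * ((((α x).1 _ : ℝ) : ℂ) + Complex.I * ((α x).1 _ : ℝ)) = _
  push_cast
  ring

end Parallel

end PseudohermitianStructure

/-! ### Contractions separate the elements of an exterior algebra -/

section Euler

variable {K V : Type*} [Field K] [AddCommGroup V] [Module K V]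
  {κ : Type*} [Fintype κ]

/-- The Euler operator `∑ᵢ bᵢ ∧ ι(bⁱ)` of an exterior algebra, which multiplies every element of
degree `r` by `r`. -/
def eulerOp (b : Module.Basis κ K V) : ExteriorAlgebra K V →ₗ[K] ExteriorAlgebra K V :=
  ∑ i, LinearMap.mulLeft K (ExteriorAlgebra.ι K (b i)) ∘ₗ
    CliffordAlgebra.contractLeft (Q := (0 : QuadraticForm K V)) (b.coord i)

theorem eulerOp_apply (b : Module.Basis κ K V) (s : ExteriorAlgebra K V) :
    eulerOp b s = ∑ i, ExteriorAlgebra.ι K (b i) *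
      CliffordAlgebra.contractLeft (Q := (0 : QuadraticForm K V)) (b.coord i) s := by
  simp [eulerOp]

theorem eulerOp_ι_mul (b : Module.Basis κ K V) (v : V) (s : ExteriorAlgebra K V) :
    eulerOp b (ExteriorAlgebra.ι K v * s) =
      ExteriorAlgebra.ι K v * s + ExteriorAlgebra.ι K v * eulerOp b s := by
  have h1 : ∀ i, CliffordAlgebra.contractLeft (Q := (0 : QuadraticForm K V)) (b.coord i)
      (ExteriorAlgebra.ι K v * s) = b.coord i v • s - ExteriorAlgebra.ι K v *
        CliffordAlgebra.contractLeft (Q := (0 : QuadraticForm K V)) (b.coord i) s :=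
    fun i ↦ CliffordAlgebra.contractLeft_ι_mul _ _ _
  have h2 : ∑ i, b.coord i v • ExteriorAlgebra.ι K (b i) = ExteriorAlgebra.ι K v := by
    conv_rhs => rw [← b.sum_repr v, map_sum]
    simp
  have h3 : ∀ i, ExteriorAlgebra.ι K (b i) * ExteriorAlgebra.ι K v
      = - (ExteriorAlgebra.ι K v * ExteriorAlgebra.ι K (b i)) := fun i ↦
    eq_neg_of_add_eq_zero_left (ExteriorAlgebra.ι_add_mul_swap _ _)
  have h4 : ExteriorAlgebra.ι K v * s = ∑ i, b.coord i v • ExteriorAlgebra.ι K (b i) * s := by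
    rw [← Finset.sum_mul, h2]
  rw [eulerOp_apply, eulerOp_apply, Finset.mul_sum]
  conv_rhs => rw [h4, ← Finset.sum_add_distrib]
  refine Finset.sum_congr rfl fun i _ ↦ ?_
  rw [h1, mul_sub, ← mul_assoc, ← mul_assoc, h3, neg_mul, sub_neg_eq_add, mul_smul_comm,
    smul_mul_assoc]

theorem eulerOp_of_mem (b : Module.Basis κ K V) {r : ℕ} {s : ExteriorAlgebra K V}
    (hs : s ∈ ⋀[K]^r V) : eulerOp b s = (r : K) • s := by
  induction hs using Submodule.pow_induction_on_left' with
  | algebraMap c => simp [eulerOp_apply]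
  | add x y i _ _ hx hy => rw [map_add, hx, hy, smul_add]
  | mem_mul m hm i x _ hx =>
    obtain ⟨v, rfl⟩ := hm
    rw [eulerOp_ι_mul, hx]
    push_cast
    rw [add_smul, one_smul, add_comm, mul_smul_comm]

open DirectSum in
open scoped Classical in
/-- An element of an exterior algebra over a field of characteristic zero vanishes if its scalar
part and all its contractions vanish. -/
theorem exteriorAlgebra_eq_zero [CharZero K] [FiniteDimensional K V] {s : ExteriorAlgebra K V}
    (h0 : ExteriorAlgebra.algebraMapInv s = 0)
    (h1 : ∀ d : Module.Dual K V,
      CliffordAlgebra.contractLeft (Q := (0 : QuadraticForm K V)) d s = 0) : s = 0 := by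
  let b := Module.finBasis K V
  have h2 : eulerOp b s = 0 := by simp [eulerOp_apply, h1]
  have h3 : ∀ (t : ExteriorAlgebra K V) (r : ℕ),
      (decompose (fun i : ℕ ↦ ⋀[K]^i V) (eulerOp b t) r : ExteriorAlgebra K V)
        = (r : K) • (decompose (fun i : ℕ ↦ ⋀[K]^i V) t r : ExteriorAlgebra K V) := by
    intro t r
    induction t using DirectSum.Decomposition.inductionOn (fun i : ℕ ↦ ⋀[K]^i V) with
    | zero => simp
    | @homogeneous i m =>
      rw [eulerOp_of_mem b m.2, decompose_smul, DirectSum.smul_apply, Submodule.coe_smul]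
      by_cases hi : i = r
      · subst hi
        rfl
      · rw [decompose_of_mem_ne (fun i : ℕ ↦ ⋀[K]^i V) m.2 hi, smul_zero, smul_zero]
    | add x y hx hy =>
      rw [map_add, decompose_add, decompose_add, DirectSum.add_apply, DirectSum.add_apply,
        Submodule.coe_add, Submodule.coe_add, hx, hy, smul_add]
  have h4 : ∀ r : ℕ, r ≠ 0 →
      (decompose (fun i : ℕ ↦ ⋀[K]^i V) s r : ExteriorAlgebra K V) = 0 := by
    intro r hr
    have h5 := h3 s r
    rw [h2, decompose_zero, DirectSum.zero_apply, ZeroMemClass.coe_zero] at h5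
    exact (smul_eq_zero.1 h5.symm).resolve_left (Nat.cast_ne_zero.2 hr)
  have h6 : s = (decompose (fun i : ℕ ↦ ⋀[K]^i V) s 0 : ExteriorAlgebra K V) := by
    conv_lhs => rw [← sum_support_decompose (fun i : ℕ ↦ ⋀[K]^i V) s]
    refine Finset.sum_eq_single 0 (fun r _ hr ↦ h4 r hr) fun h ↦ ?_
    simpa using h
  have h7 : s ∈ ⋀[K]^0 V := by
    rw [h6]
    exact Subtype.mem _
  change s ∈ LinearMap.range (ExteriorAlgebra.ι K) ^ 0 at h7
  rw [pow_zero, Submodule.mem_one] at h7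
  obtain ⟨c, rfl⟩ := h7
  have h8 : ExteriorAlgebra.algebraMapInv (algebraMap K (ExteriorAlgebra K V) c) = c :=
    ExteriorAlgebra.algebraMap_leftInverse V c
  rw [← h8, h0, map_zero]

end Euler

namespace PseudohermitianStructure

/-! ### Calculus of local expressions -/

section Values

variable {M : Type*} {A V : M → Type*} [∀ x, Ring (A x)] (ι : Π x, V x → A x)

/-- The product of a function and an expression. -/
def scaleExpr (f : M → ℂ) (e : Expr V) : Expr V := e.map fun t ↦ (fun y ↦ f y * t.1 y, t.2)

/-- The expression obtained by multiplying every word on the left by `α`. -/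
def consExpr (α : Π x : M, V x) (e : Expr V) : Expr V := e.map fun t ↦ (t.1, α :: t.2)

@[simp]
theorem wordVal_nil (x : M) : wordVal ι [] x = 1 := rfl

@[simp]
theorem wordVal_cons (α : Π x : M, V x) (l : List (Π x : M, V x)) (x : M) :
    wordVal ι (α :: l) x = ι x (α x) * wordVal ι l x := by
  simp [wordVal]

variable [∀ x, Algebra ℂ (A x)]

@[simp]
theorem exprVal_nil (x : M) : exprVal ι [] x = 0 := rfl

@[simp]
theorem exprVal_cons (t : (M → ℂ) × List (Π x : M, V x)) (e : Expr V) (x : M) :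
    exprVal ι (t :: e) x = t.1 x • wordVal ι t.2 x + exprVal ι e x := by
  simp [exprVal]

@[simp]
theorem exprVal_append (e e' : Expr V) (x : M) :
    exprVal ι (e ++ e') x = exprVal ι e x + exprVal ι e' x := by
  simp [exprVal]

@[simp]
theorem exprVal_scaleExpr (f : M → ℂ) (e : Expr V) (x : M) :
    exprVal ι (scaleExpr f e) x = f x • exprVal ι e x := by
  induction e with
  | nil => simp [scaleExpr]
  | cons t e ih =>
    rw [exprVal_cons, smul_add, ← ih, smul_smul]
    simp [scaleExpr]

@[simp]
theorem exprVal_consExpr (α : Π x : M, V x) (e : Expr V) (x : M) :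
    exprVal ι (consExpr α e) x = ι x (α x) * exprVal ι e x := by
  induction e with
  | nil => simp [consExpr]
  | cons t e ih =>
    rw [exprVal_cons, mul_add, ← ih, mul_smul_comm, ← wordVal_cons]
    simp [consExpr]

end Values

section Derivatives

variable {F : Type*} [NormedAddCommGroup F] [NormedSpace ℝ F]
  {H : Type*} [TopologicalSpace H] {I : ModelWithCorners ℝ F H}
  {M : Type*} [TopologicalSpace M] [ChartedSpace H M]
  {A V : M → Type*} [∀ x, Ring (A x)] [∀ x, Algebra ℂ (A x)]

/-- `e` is an expression in smooth functions and smooth sections. -/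
def SmoothExpr (I : ModelWithCorners ℝ F H) (smoothV : (Π x : M, V x) → Prop) (e : Expr V) :
    Prop :=
  ∀ t ∈ e, ContMDiff I 𝓘(ℝ, ℂ) ∞ t.1 ∧ ∀ α ∈ t.2, smoothV α

variable {smoothV : (Π x : M, V x) → Prop}

theorem SmoothExpr.nil : SmoothExpr I smoothV [] := by simp [SmoothExpr]

theorem SmoothExpr.of_cons {t : (M → ℂ) × List (Π x : M, V x)} {e : Expr V}
    (h : SmoothExpr I smoothV (t :: e)) : SmoothExpr I smoothV e :=
  fun u hu ↦ h u (List.mem_cons_of_mem _ hu)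

theorem SmoothExpr.append {e e' : Expr V} (h : SmoothExpr I smoothV e)
    (h' : SmoothExpr I smoothV e') : SmoothExpr I smoothV (e ++ e') := fun t ht ↦
  (List.mem_append.1 ht).elim (h t) (h' t)

theorem SmoothExpr.scale {f : M → ℂ} {e : Expr V} (hf : ContMDiff I 𝓘(ℝ, ℂ) ∞ f)
    (h : SmoothExpr I smoothV e) : SmoothExpr I smoothV (scaleExpr f e) := by
  intro t ht
  obtain ⟨u, hu, rfl⟩ := List.mem_map.1 ht
  exact ⟨contMDiff_complex_mul hf (h u hu).1, (h u hu).2⟩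

theorem SmoothExpr.cons {α : Π x : M, V x} {e : Expr V} (hα : smoothV α)
    (h : SmoothExpr I smoothV e) : SmoothExpr I smoothV (consExpr α e) := by
  intro t ht
  obtain ⟨u, hu, rfl⟩ := List.mem_map.1 ht
  refine ⟨(h u hu).1, fun β hβ ↦ ?_⟩
  rcases List.mem_cons.1 hβ with rfl | hβ
  exacts [hα, (h u hu).2 β hβ]

variable (ι : Π x, V x → A x) {x : M} (v : TangentSpace I x) (D : (Π x : M, V x) → V x)

@[simp]
theorem exprDeriv_nil : exprDeriv ι x v D [] = 0 := rfl

@[simp]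
theorem exprDeriv_cons (t : (M → ℂ) × List (Π x : M, V x)) (e : Expr V) :
    exprDeriv ι x v D (t :: e) = mvfderiv I t.1 x v • wordVal ι t.2 x
      + t.1 x • wordDeriv ι x D t.2 + exprDeriv ι x v D e := by
  simp [exprDeriv]

@[simp]
theorem exprDeriv_append (e e' : Expr V) :
    exprDeriv ι x v D (e ++ e') = exprDeriv ι x v D e + exprDeriv ι x v D e' := by
  simp [exprDeriv]

theorem exprDeriv_scaleExpr {f : M → ℂ} {e : Expr V} (hf : ContMDiff I 𝓘(ℝ, ℂ) ∞ f)
    (he : SmoothExpr I smoothV e) :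
    exprDeriv ι x v D (scaleExpr f e)
      = mvfderiv I f x v • exprVal ι e x + f x • exprDeriv ι x v D e := by
  induction e with
  | nil => simp [scaleExpr]
  | cons t e ih =>
    have h1 : scaleExpr f (t :: e) = (fun y ↦ f y * t.1 y, t.2) :: scaleExpr f e := rfl
    have h2 : MDifferentiableAt I 𝓘(ℝ, ℂ) f x := hf.mdifferentiable (by simp) x
    have h3 : MDifferentiableAt I 𝓘(ℝ, ℂ) t.1 x :=
      (he t List.mem_cons_self).1.mdifferentiable (by simp) x
    rw [h1, exprDeriv_cons, ih he.of_cons, exprDeriv_cons, exprVal_cons,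
      mvfderiv_complex_mul h2 h3]
    module

theorem exprDeriv_consExpr (α : Π x : M, V x) (e : Expr V) :
    exprDeriv ι x v D (consExpr α e)
      = ι x (D α) * exprVal ι e x + ι x (α x) * exprDeriv ι x v D e := by
  induction e with
  | nil => simp [consExpr]
  | cons t e ih =>
    have h1 : consExpr α (t :: e) = (t.1, α :: t.2) :: consExpr α e := rfl
    rw [h1, exprDeriv_cons, ih, exprDeriv_cons, exprVal_cons]
    simp only [wordVal_cons, wordDeriv, mul_add, mul_smul_comm, smul_add]
    abel

end Derivatives

/-! ### Contraction of spinor expressions -/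

section Contraction

variable {F : Type*} [NormedAddCommGroup F] [NormedSpace ℝ F]
  [CompleteSpace F] [FiniteDimensional ℝ F] {H : Type*} [TopologicalSpace H]
  {I : ModelWithCorners ℝ F H} {M : Type*} [TopologicalSpace M] [ChartedSpace H M]
  [IsManifold I ∞ M] (S : PseudohermitianStructure I M)

/-- Contraction of spinors with a real tangent vector `w`; elements of `E^{0,1}` see only the
`E_{0,1}`-component of `w`. -/
def contraction (x : M) (w : TangentSpace I x) : Module.End ℂ (S.Spinor x) :=
  CliffordAlgebra.contractLeft (S.evalAt x w)

theorem contraction_one (x : M) (w : TangentSpace I x) : S.contraction x w 1 = 0 :=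
  CliffordAlgebra.contractLeft_one _ _

theorem contraction_ιS_mul (x : M) (w : TangentSpace I x) (β : S.Eform01 x) (s : S.Spinor x) :
    S.contraction x w (S.ιS x β * s) = (β.1 w : ℂ) • s - S.ιS x β * S.contraction x w s :=
  CliffordAlgebra.contractLeft_ι_mul _ _ _

theorem finiteDimensional_Eform01 (x : M) : FiniteDimensional ℂ (S.Eform01 x) := by
  have h1 : FiniteDimensional ℝ (Form I ℂ x) :=
    inferInstanceAs (FiniteDimensional ℝ (F →L[ℝ] ℂ))
  have h2 : FiniteDimensional ℂ (Form I ℂ x) := Module.Finite.of_restrictScalars_finite ℝ ℂ _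
  infer_instance

/-- A spinor vanishes if its scalar part and its contractions with real tangent vectors vanish. -/
theorem spinor_eq_zero {x : M} {s : S.Spinor x} (h0 : ExteriorAlgebra.algebraMapInv s = 0)
    (h1 : ∀ w : TangentSpace I x, S.contraction x w s = 0) : s = 0 := by
  have := S.finiteDimensional_Eform01 x
  refine exteriorAlgebra_eq_zero h0 fun d ↦ ?_
  -- The evaluations at real tangent vectors span the dual of `E^{0,1}`.
  have h2 : Submodule.span ℂ (Set.range (S.evalAt x)) = ⊤ := by
    rw [← Subspace.dualCoannihilator_dualAnnihilator_eq
      (W := Submodule.span ℂ (Set.range (S.evalAt x)))]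
    have h3 : (Submodule.span ℂ (Set.range (S.evalAt x))).dualCoannihilator = ⊥ := by
      refine (Submodule.eq_bot_iff _).2 fun β hβ ↦ ?_
      rw [Submodule.mem_dualCoannihilator] at hβ
      ext w
      exact hβ _ (Submodule.subset_span ⟨w, rfl⟩)
    rw [h3, Submodule.dualAnnihilator_bot]
  have h4 : d ∈ Submodule.span ℂ (Set.range (S.evalAt x)) := h2 ▸ Submodule.mem_top
  induction h4 using Submodule.span_induction with
  | mem d hd =>
    obtain ⟨w, rfl⟩ := hd
    exact h1 w
  | zero => simp
  | add d d' _ _ hd hd' => rw [map_add, LinearMap.add_apply, hd, hd', add_zero]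
  | smul c d _ hd => rw [map_smul, LinearMap.smul_apply, hd, smul_zero]

/-- Formal finite sums of products of functions and sections of `E^{0,1}`. -/
abbrev SpinorExpr : Type _ := Expr fun x : M ↦ S.Eform01 x

/-- `e` is an expression in smooth functions and smooth sections of `E^{0,1}`. -/
abbrev SmoothSpinorExpr (e : S.SpinorExpr) : Prop :=
  SmoothExpr I (fun β : Π x : M, S.Eform01 x ↦ SmoothForm fun x ↦ (β x).1) e

/-- `e` is an expression in smooth data for the spinor field `s` near `x`. -/
abbrev IsLocalSpinorExpr (s : Π x : M, S.Spinor x) (x : M) (e : S.SpinorExpr) : Prop :=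
  IsLocalExpr I S.ιS (fun β : Π x : M, S.Eform01 x ↦ SmoothForm fun x ↦ (β x).1) s x e

/-- The contraction `∑ⱼ (-1)^(j-1) βⱼ(Y) β₁ ⋯ β̂ⱼ ⋯ β_r` of a word with a vector field. -/
def contrWord (Y : Π x : M, TangentSpace I x) : List (Π x : M, S.Eform01 x) → S.SpinorExpr
  | [] => []
  | β :: l => (fun y ↦ ((β y).1 (Y y) : ℂ), l) :: scaleExpr (fun _ ↦ -1)
      (consExpr β (contrWord Y l))

/-- The contraction of an expression with a vector field. -/
def contrExpr (Y : Π x : M, TangentSpace I x) (e : S.SpinorExpr) : S.SpinorExpr :=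
  e.flatMap fun t ↦ scaleExpr t.1 (S.contrWord Y t.2)

variable {S} {Y : Π x : M, TangentSpace I x}

theorem contrExpr_cons (t : (M → ℂ) × List (Π x : M, S.Eform01 x)) (e : S.SpinorExpr) :
    S.contrExpr Y (t :: e) = scaleExpr t.1 (S.contrWord Y t.2) ++ S.contrExpr Y e := rfl

theorem length_of_mem_contrWord (l : List (Π x : M, S.Eform01 x)) :
    ∀ t ∈ S.contrWord Y l, t.2.length + 1 = l.length := by
  induction l with
  | nil => simp [contrWord]
  | cons β l ih =>
    intro t ht
    rcases List.mem_cons.1 ht with rfl | ht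
    · rfl
    · obtain ⟨u, hu, rfl⟩ := List.mem_map.1 ht
      obtain ⟨u', hu', rfl⟩ := List.mem_map.1 hu
      simpa using ih u' hu'

theorem smoothExpr_contrWord (hY : SmoothField I Y) {l : List (Π x : M, S.Eform01 x)}
    (hl : ∀ β ∈ l, SmoothForm fun x ↦ (β x).1) :
    S.SmoothSpinorExpr (S.contrWord Y l) := by
  induction l with
  | nil => exact SmoothExpr.nil
  | cons β l ih =>
    have hβ := hl β List.mem_cons_self
    have hl' := fun γ hγ ↦ hl γ (List.mem_cons_of_mem _ hγ)
    intro t ht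
    rcases List.mem_cons.1 ht with rfl | ht
    · exact ⟨hβ.contMDiff_apply hY, hl'⟩
    · exact SmoothExpr.scale contMDiff_const (SmoothExpr.cons
        (smoothV := fun β : Π x : M, S.Eform01 x ↦ SmoothForm fun x ↦ (β x).1) hβ (ih hl')) t ht

theorem smoothExpr_contrExpr (hY : SmoothField I Y) {e : S.SpinorExpr}
    (he : S.SmoothSpinorExpr e) :
    S.SmoothSpinorExpr (S.contrExpr Y e) := by
  intro t ht
  obtain ⟨u, hu, ht⟩ := List.mem_flatMap.1 ht
  exact (smoothExpr_contrWord hY (he u hu).2).scale (he u hu).1 t ht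

theorem exprVal_contrWord (l : List (Π x : M, S.Eform01 x)) (x : M) :
    exprVal S.ιS (S.contrWord Y l) x = S.contraction x (Y x) (wordVal S.ιS l x) := by
  induction l with
  | nil => simp [contrWord, contraction_one]
  | cons β l ih =>
    rw [contrWord, exprVal_cons, exprVal_scaleExpr, exprVal_consExpr, ih, wordVal_cons,
      contraction_ιS_mul]
    module

theorem exprVal_contrExpr (e : S.SpinorExpr) (x : M) :
    exprVal S.ιS (S.contrExpr Y e) x = S.contraction x (Y x) (exprVal S.ιS e x) := by
  induction e with
  | nil => simp [contrExpr]
  | cons t e ih =>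
    rw [contrExpr_cons, exprVal_append, exprVal_scaleExpr, exprVal_contrWord, ih, exprVal_cons,
      map_add, map_smul]

variable {cov : CovariantDerivative I F (TangentSpace I : M → Type _)}

/-- The Leibniz rule `∇ (ι(Y) s) = ι(Y) ∇ s + ι(∇ Y) s` on words. -/
theorem exprDeriv_contrWord (h : S.IsTanakaWebster cov) (hY : SmoothField I Y)
    {l : List (Π x : M, S.Eform01 x)} (hl : ∀ β ∈ l, SmoothForm fun x ↦ (β x).1)
    (x : M) (v : TangentSpace I x) :
    exprDeriv S.ιS x v (fun β ↦ covEform01 h β x v) (S.contrWord Y l)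
      = S.contraction x (Y x) (wordDeriv S.ιS x (fun β ↦ covEform01 h β x v) l)
        + S.contraction x (cov Y x v) (wordVal S.ιS l x) := by
  induction l with
  | nil => simp [contrWord, contraction_one, wordDeriv]
  | cons β l ih =>
    have hβ := hl β List.mem_cons_self
    have hl' := fun γ hγ ↦ hl γ (List.mem_cons_of_mem _ hγ)
    have h1 : mvfderiv I (fun y ↦ ((β y).1 (Y y) : ℂ)) x v
        = ((covEform01 h β x v).1 (Y x) : ℂ) + ((β x).1 (cov Y x v) : ℂ) :=
      (sub_eq_iff_eq_add.1 (covForm_apply cov hβ v (hY.mdifferentiableAt x)).symm)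
    have h2 : mvfderiv I (fun _ : M ↦ (-1 : ℂ)) x = 0 := mvfderiv_const _
    rw [contrWord, exprDeriv_cons,
      exprDeriv_scaleExpr S.ιS v _ contMDiff_const ((smoothExpr_contrWord hY hl').cons hβ),
      exprDeriv_consExpr, exprVal_consExpr, exprVal_contrWord, ih hl', wordVal_cons, wordDeriv,
      map_add, contraction_ιS_mul, contraction_ιS_mul, contraction_ιS_mul, h1, h2, mul_add]
    simp only [zero_apply]
    module

theorem exprDeriv_contrExpr (h : S.IsTanakaWebster cov) (hY : SmoothField I Y)
    {e : S.SpinorExpr} (he : S.SmoothSpinorExpr e)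
    (x : M) (v : TangentSpace I x) :
    exprDeriv S.ιS x v (fun β ↦ covEform01 h β x v) (S.contrExpr Y e)
      = S.contraction x (Y x) (exprDeriv S.ιS x v (fun β ↦ covEform01 h β x v) e)
        + S.contraction x (cov Y x v) (exprVal S.ιS e x) := by
  induction e with
  | nil => simp [contrExpr]
  | cons t e ih =>
    have ht := he t List.mem_cons_self
    rw [contrExpr_cons, exprDeriv_append,
      exprDeriv_scaleExpr S.ιS v _ ht.1 (smoothExpr_contrWord hY ht.2), ih he.of_cons,
      exprVal_contrWord, exprDeriv_contrWord h hY ht.2, exprDeriv_cons, exprVal_cons]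
    simp only [map_add, map_smul]
    module

/-! ### The spinor connection does not depend on the local expression -/

theorem algebraMapInv_ιS_mul (x : M) (β : S.Eform01 x) (s : S.Spinor x) :
    ExteriorAlgebra.algebraMapInv (S.ιS x β * s) = 0 := by
  rw [map_mul]
  simp [ιS, ExteriorAlgebra.algebraMapInv]

/-- The scalar part of the derivative of an expression is the derivative of its scalar part. -/
theorem algebraMapInv_exprDeriv (h : S.IsTanakaWebster cov) {e : S.SpinorExpr}
    (he : S.SmoothSpinorExpr e) (x : M) (v : TangentSpace I x) :
    MDifferentiableAt I 𝓘(ℝ, ℂ) (fun y ↦ ExteriorAlgebra.algebraMapInv (exprVal S.ιS e y)) x ∧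
    ExteriorAlgebra.algebraMapInv (exprDeriv S.ιS x v (fun β ↦ covEform01 h β x v) e)
      = mvfderiv I (fun y ↦ ExteriorAlgebra.algebraMapInv (exprVal S.ιS e y)) x v := by
  induction e with
  | nil =>
    have h2 : mvfderiv I (fun _ : M ↦ (0 : ℂ)) x = 0 := mvfderiv_const _
    simp [h2, mdifferentiableAt_const]
  | cons t e ih =>
    obtain ⟨f, l⟩ := t
    obtain ⟨ih1, ih2⟩ := ih he.of_cons
    have hf : MDifferentiableAt I 𝓘(ℝ, ℂ) f x :=
      (he _ List.mem_cons_self).1.mdifferentiable (by simp) x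
    cases l with
    | nil =>
      simp only [exprVal_cons, exprDeriv_cons, wordVal_nil, wordDeriv, map_add, map_smul, map_one,
        smul_zero, add_zero, smul_eq_mul, mul_one]
      exact ⟨hf.add ih1, by rw [mvfderiv_fun_add hf ih1, add_apply, ih2]⟩
    | cons β l =>
      simp only [exprVal_cons, exprDeriv_cons, wordVal_cons, wordDeriv, map_add, map_smul,
        algebraMapInv_ιS_mul, smul_zero, zero_add]
      exact ⟨ih1, ih2⟩

variable [T2Space M]

/-- An expression whose value vanishes near a point has derivative zero at this point. -/
theorem exprDeriv_eq_zero (h : S.IsTanakaWebster cov) {e : S.SpinorExpr}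
    (he : S.SmoothSpinorExpr e) (x : M) (v : TangentSpace I x)
    (h0 : ∀ᶠ y in 𝓝 x, exprVal S.ιS e y = 0) :
    exprDeriv S.ιS x v (fun β ↦ covEform01 h β x v) e = 0 := by
  -- Contraction with a vector field shortens the words and preserves the hypothesis.
  suffices H : ∀ (N : ℕ) (e : S.SpinorExpr),
      S.SmoothSpinorExpr e → (∀ t ∈ e, t.2.length < N) →
      (∀ᶠ y in 𝓝 x, exprVal S.ιS e y = 0) →
      exprDeriv S.ιS x v (fun β ↦ covEform01 h β x v) e = 0 by
    refine H ((e.map fun t ↦ t.2.length).sum + 1) e he (fun t ht ↦ ?_) h0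
    exact Nat.lt_succ_of_le (List.single_le_sum (by simp) _ (List.mem_map_of_mem ht))
  intro N
  induction N with
  | zero =>
    intro e _ hN _
    cases e with
    | nil => rfl
    | cons t e => exact absurd (hN t List.mem_cons_self) (Nat.not_lt_zero _)
  | succ N ih =>
    intro e he hN h0
    refine S.spinor_eq_zero ?_ fun w ↦ ?_
    · rw [(algebraMapInv_exprDeriv h he x v).2]
      have h1 : (fun y ↦ ExteriorAlgebra.algebraMapInv (exprVal S.ιS e y))
          =ᶠ[𝓝 x] fun _ ↦ (0 : ℂ) := h0.mono fun y hy ↦ by simp only [hy, map_zero]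
      have h2 : mvfderiv I (fun _ : M ↦ (0 : ℂ)) x = 0 := mvfderiv_const _
      rw [mvfderiv_apply_congr h1, h2, zero_apply]
    · obtain ⟨Y, hY, rfl⟩ := exists_smoothField_apply_eq w
      have h1 := exprDeriv_contrExpr h hY he x v
      rw [h0.self_of_nhds, map_zero, add_zero] at h1
      rw [← h1]
      refine ih _ (smoothExpr_contrExpr hY he) (fun t ht ↦ ?_) ?_
      · obtain ⟨u, hu, ht⟩ := List.mem_flatMap.1 ht
        obtain ⟨u', hu', rfl⟩ := List.mem_map.1 ht
        have h2 := length_of_mem_contrWord _ u' hu'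
        have h3 := hN u hu
        simp only
        omega
      · filter_upwards [h0] with y hy
        rw [exprVal_contrExpr, hy, map_zero]

/-- The spinor connection may be computed from any local expression. -/
theorem covSpinor_eq (h : S.IsTanakaWebster cov) {s : Π x : M, S.Spinor x} {x : M}
    {e : S.SpinorExpr}
    (he : S.IsLocalSpinorExpr s x e) (v : TangentSpace I x) :
    covSpinor h s x v = exprDeriv S.ιS x v (fun β ↦ covEform01 h β x v) e := by
  have hex : ∃ e, S.IsLocalSpinorExpr s x e := ⟨e, he⟩
  rw [covSpinor, inducedConnection, dif_pos hex]
  obtain ⟨h1, h2⟩ := hex.choose_spec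
  set e' := hex.choose
  have h3 := exprDeriv_eq_zero h (SmoothExpr.append h1 (SmoothExpr.scale contMDiff_const he.1))
    (e := e' ++ scaleExpr (fun _ ↦ -1) e) x v (by
      filter_upwards [h2, he.2] with y hy hy'
      rw [exprVal_append, exprVal_scaleExpr, ← hy, ← hy']
      module)
  have h4 : mvfderiv I (fun _ : M ↦ (-1 : ℂ)) x = 0 := mvfderiv_const _
  rw [exprDeriv_append, exprDeriv_scaleExpr S.ιS v _ contMDiff_const he.1, h4, zero_apply,
    zero_smul, zero_add, neg_one_smul, add_neg_eq_zero] at h3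
  exact h3

end Contraction

section Connection

variable {F : Type*} [NormedAddCommGroup F] [NormedSpace ℝ F]
  [CompleteSpace F] [FiniteDimensional ℝ F] {H : Type*} [TopologicalSpace H]
  {I : ModelWithCorners ℝ F H} {M : Type*} [TopologicalSpace M] [ChartedSpace H M]
  [IsManifold I ∞ M] {S : PseudohermitianStructure I M}

/-! ### Smooth spinor fields -/

section LocalExpr

variable {s t : Π x : M, S.Spinor x} {x : M} {e e' : S.SpinorExpr}

theorem IsLocalSpinorExpr.congr (he : S.IsLocalSpinorExpr s x e) (hst : ∀ᶠ y in 𝓝 x, s y = t y) :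
    S.IsLocalSpinorExpr t x e :=
  ⟨he.1, by filter_upwards [he.2, hst] with y h1 h2 using h2.symm.trans h1⟩

theorem IsLocalSpinorExpr.append (he : S.IsLocalSpinorExpr s x e)
    (he' : S.IsLocalSpinorExpr t x e') : S.IsLocalSpinorExpr (fun y ↦ s y + t y) x (e ++ e') :=
  ⟨SmoothExpr.append he.1 he'.1, by
    filter_upwards [he.2, he'.2] with y h1 h2
    rw [exprVal_append, h1, h2]⟩

theorem IsLocalSpinorExpr.scale (he : S.IsLocalSpinorExpr s x e) {f : M → ℂ}
    (hf : ContMDiff I 𝓘(ℝ, ℂ) ∞ f) :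
    S.IsLocalSpinorExpr (fun y ↦ f y • s y) x (scaleExpr f e) :=
  ⟨SmoothExpr.scale hf he.1, by
    filter_upwards [he.2] with y h1
    rw [exprVal_scaleExpr, h1]⟩

theorem IsLocalSpinorExpr.cons (he : S.IsLocalSpinorExpr s x e) {β : Π x : M, S.Eform01 x}
    (hβ : SmoothForm fun x ↦ (β x).1) :
    S.IsLocalSpinorExpr (fun y ↦ S.ιS y (β y) * s y) x (consExpr β e) :=
  ⟨SmoothExpr.cons hβ he.1, by
    filter_upwards [he.2] with y h1
    rw [exprVal_consExpr, h1]⟩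

theorem IsLocalSpinorExpr.contr (he : S.IsLocalSpinorExpr s x e)
    {Y : Π x : M, TangentSpace I x} (hY : SmoothField I Y) :
    S.IsLocalSpinorExpr (fun y ↦ S.contraction y (Y y) (s y)) x (S.contrExpr Y e) :=
  ⟨smoothExpr_contrExpr hY he.1, by
    filter_upwards [he.2] with y h1
    rw [exprVal_contrExpr, h1]⟩

end LocalExpr

variable {s t : Π x : M, S.Spinor x}

theorem SmoothSpinor.zero : S.SmoothSpinor fun _ ↦ 0 := fun _ ↦
  ⟨[], SmoothExpr.nil, Filter.Eventually.of_forall fun _ ↦ rfl⟩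

theorem SmoothSpinor.one : S.SmoothSpinor fun _ ↦ 1 := fun _ ↦
  ⟨[(fun _ ↦ 1, [])], by simp [contMDiff_const], Filter.Eventually.of_forall fun _ ↦ by simp⟩

theorem SmoothSpinor.add (hs : S.SmoothSpinor s) (ht : S.SmoothSpinor t) :
    S.SmoothSpinor fun y ↦ s y + t y := fun x ↦ by
  obtain ⟨e, he⟩ := hs x
  obtain ⟨e', he'⟩ := ht x
  exact ⟨_, IsLocalSpinorExpr.append he he'⟩

theorem SmoothSpinor.smul {f : M → ℂ} (hf : ContMDiff I 𝓘(ℝ, ℂ) ∞ f) (hs : S.SmoothSpinor s) :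
    S.SmoothSpinor fun y ↦ f y • s y := fun x ↦ by
  obtain ⟨e, he⟩ := hs x
  exact ⟨_, IsLocalSpinorExpr.scale he hf⟩

theorem SmoothSpinor.ιS_mul {β : Π x : M, S.Eform01 x} (hβ : SmoothForm fun x ↦ (β x).1)
    (hs : S.SmoothSpinor s) : S.SmoothSpinor fun y ↦ S.ιS y (β y) * s y := fun x ↦ by
  obtain ⟨e, he⟩ := hs x
  exact ⟨_, IsLocalSpinorExpr.cons he hβ⟩

theorem SmoothSpinor.contraction {Y : Π x : M, TangentSpace I x} (hY : SmoothField I Y)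
    (hs : S.SmoothSpinor s) : S.SmoothSpinor fun y ↦ S.contraction y (Y y) (s y) := fun x ↦ by
  obtain ⟨e, he⟩ := hs x
  exact ⟨_, IsLocalSpinorExpr.contr he hY⟩

/-- Smoothness of spinor fields is a local property. -/
theorem smoothSpinor_of_locally
    (h : ∀ x, ∃ t, S.SmoothSpinor t ∧ ∀ᶠ y in 𝓝 x, t y = s y) : S.SmoothSpinor s := fun x ↦ by
  obtain ⟨t, ht, hts⟩ := h x
  obtain ⟨e, he⟩ := ht x
  exact ⟨e, IsLocalSpinorExpr.congr he hts⟩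

theorem SmoothSpinor.wordVal {l : List (Π x : M, S.Eform01 x)}
    (hl : ∀ β ∈ l, SmoothForm fun x ↦ (β x).1) :
    S.SmoothSpinor fun y ↦ PseudohermitianStructure.wordVal S.ιS l y := by
  induction l with
  | nil => exact SmoothSpinor.one
  | cons β l ih =>
    simp only [wordVal_cons]
    exact (ih fun γ hγ ↦ hl γ (List.mem_cons_of_mem _ hγ)).ιS_mul (hl β List.mem_cons_self)

/-! ### The Clifford action on a fibre -/

theorem cliffordAction_add_apply (x : M) (a b : S.Cl x) (s : S.Spinor x) :
    S.cliffordAction x (a + b) s = S.cliffordAction x a s + S.cliffordAction x b s :=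
  LinearMap.congr_fun ((S.cliffordAction x).map_add' a b) s

theorem cliffordAction_mul_apply (x : M) (a b : S.Cl x) (s : S.Spinor x) :
    S.cliffordAction x (a * b) s = S.cliffordAction x a (S.cliffordAction x b s) :=
  LinearMap.congr_fun ((S.cliffordAction x).map_mul' a b) s

theorem cliffordAction_smul_apply (x : M) (c : ℂ) (a : S.Cl x) (s : S.Spinor x) :
    S.cliffordAction x (c • a) s = c • S.cliffordAction x a s :=
  LinearMap.congr_fun ((S.cliffordAction x).toLinearMap.map_smul c a) s

theorem cliffordAction_ιCl (x : M) (α : S.Estar x) (s : S.Spinor x) :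
    S.cliffordAction x (S.ιCl x α) s = ((√2 : ℝ) : ℂ) • (S.ιS x (S.part01 x α) * s)
      + (-((√2 : ℝ) : ℂ)) • S.contraction x (S.sharp x α.1) s := by
  have h1 : S.cliffordAction x (S.ιCl x α) = S.cliffordActionι x α := by
    have h3 := DFunLike.congr_fun (Algebra.TensorProduct.lift_comp_includeRight
      (Algebra.ofId ℂ (Module.End ℂ (S.Spinor x)))
      (CliffordAlgebra.lift (S.Q x) ⟨S.cliffordActionι x, S.cliffordActionι_mul_self x⟩)
      (fun c _ ↦ Algebra.commutes c _)) (CliffordAlgebra.ι (S.Q x) α)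
    exact h3.trans (CliffordAlgebra.lift_ι_apply _ _ _)
  have h2 : S.cliffordActionι x α s = ((√2 : ℝ) : ℂ) •
      (S.ιS x (S.part01 x α) * s - S.contraction x (S.sharp x α.1) s) := rfl
  rw [h1, h2, smul_sub, neg_smul, sub_eq_add_neg]

/-! ### Rules for the spinor connection -/

variable {cov : CovariantDerivative I F (TangentSpace I : M → Type _)}

theorem covEform01_add (h : S.IsTanakaWebster cov) {β : Π x : M, S.Eform01 x}
    (hβ : SmoothForm fun x ↦ (β x).1) (x : M) (v w : TangentSpace I x) :
    covEform01 h β x (v + w) = covEform01 h β x v + covEform01 h β x w := by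
  ext u
  obtain ⟨Y, hY, rfl⟩ : ∃ Y : Π x : M, TangentSpace I x, MDiffAt (T% Y) x ∧ Y x = u :=
    ⟨FiberBundle.extend F u, FiberBundle.mdifferentiableAt_extend .., by simp⟩
  change (covForm cov (fun y ↦ (β y).1) x (v + w) (Y x) : ℂ)
    = covForm cov (fun y ↦ (β y).1) x v (Y x) + covForm cov (fun y ↦ (β y).1) x w (Y x)
  rw [covForm_apply cov hβ _ hY, covForm_apply cov hβ _ hY, covForm_apply cov hβ _ hY,
    map_add, map_add, map_add]
  abel

theorem covEform01_smul (h : S.IsTanakaWebster cov) {β : Π x : M, S.Eform01 x}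
    (hβ : SmoothForm fun x ↦ (β x).1) (x : M) (c : ℝ) (v : TangentSpace I x) :
    covEform01 h β x (c • v) = (c : ℂ) • covEform01 h β x v := by
  ext u
  obtain ⟨Y, hY, rfl⟩ : ∃ Y : Π x : M, TangentSpace I x, MDiffAt (T% Y) x ∧ Y x = u :=
    ⟨FiberBundle.extend F u, FiberBundle.mdifferentiableAt_extend .., by simp⟩
  change (covForm cov (fun y ↦ (β y).1) x (c • v) (Y x) : ℂ)
    = (c : ℂ) * covForm cov (fun y ↦ (β y).1) x v (Y x)
  rw [covForm_apply cov hβ _ hY, covForm_apply cov hβ _ hY, map_smul, map_smul, map_smul,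
    ← smul_sub]
  exact Complex.real_smul

theorem wordDeriv_add (h : S.IsTanakaWebster cov) {l : List (Π x : M, S.Eform01 x)}
    (hl : ∀ β ∈ l, SmoothForm fun x ↦ (β x).1) (x : M) (v w : TangentSpace I x) :
    wordDeriv S.ιS x (fun β ↦ covEform01 h β x (v + w)) l
      = wordDeriv S.ιS x (fun β ↦ covEform01 h β x v) l
        + wordDeriv S.ιS x (fun β ↦ covEform01 h β x w) l := by
  induction l with
  | nil => simp [wordDeriv]
  | cons β l ih =>
    rw [wordDeriv, wordDeriv, wordDeriv, ih fun γ hγ ↦ hl γ (List.mem_cons_of_mem _ hγ),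
      covEform01_add h (hl β List.mem_cons_self)]
    simp only [ιS, map_add, add_mul, mul_add]
    abel

theorem wordDeriv_smul (h : S.IsTanakaWebster cov) {l : List (Π x : M, S.Eform01 x)}
    (hl : ∀ β ∈ l, SmoothForm fun x ↦ (β x).1) (x : M) (c : ℝ) (v : TangentSpace I x) :
    wordDeriv S.ιS x (fun β ↦ covEform01 h β x (c • v)) l
      = (c : ℂ) • wordDeriv S.ιS x (fun β ↦ covEform01 h β x v) l := by
  induction l with
  | nil => simp [wordDeriv]
  | cons β l ih =>
    rw [wordDeriv, wordDeriv, ih fun γ hγ ↦ hl γ (List.mem_cons_of_mem _ hγ),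
      covEform01_smul h (hl β List.mem_cons_self)]
    simp only [ιS, map_smul, smul_mul_assoc, mul_smul_comm, smul_add]

theorem exprDeriv_add (h : S.IsTanakaWebster cov) {e : S.SpinorExpr} (he : S.SmoothSpinorExpr e)
    (x : M) (v w : TangentSpace I x) :
    exprDeriv S.ιS x (v + w) (fun β ↦ covEform01 h β x (v + w)) e
      = exprDeriv S.ιS x v (fun β ↦ covEform01 h β x v) e
        + exprDeriv S.ιS x w (fun β ↦ covEform01 h β x w) e := by
  induction e with
  | nil => simp
  | cons t e ih =>
    rw [exprDeriv_cons, exprDeriv_cons, exprDeriv_cons, ih he.of_cons, map_add,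
      wordDeriv_add h (he t List.mem_cons_self).2]
    module

theorem exprDeriv_smul (h : S.IsTanakaWebster cov) {e : S.SpinorExpr} (he : S.SmoothSpinorExpr e)
    (x : M) (c : ℝ) (v : TangentSpace I x) :
    exprDeriv S.ιS x (c • v) (fun β ↦ covEform01 h β x (c • v)) e
      = (c : ℂ) • exprDeriv S.ιS x v (fun β ↦ covEform01 h β x v) e := by
  induction e with
  | nil => simp
  | cons t e ih =>
    rw [exprDeriv_cons, exprDeriv_cons, ih he.of_cons, map_smul,
      wordDeriv_smul h (he t List.mem_cons_self).2, Complex.real_smul]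
    module

variable [T2Space M]

theorem covSpinor_congr (h : S.IsTanakaWebster cov) (hs : S.SmoothSpinor s) {x : M}
    (hst : ∀ᶠ y in 𝓝 x, s y = t y) (v : TangentSpace I x) :
    covSpinor h s x v = covSpinor h t x v := by
  obtain ⟨e, he⟩ := hs x
  rw [covSpinor_eq h he, covSpinor_eq h (IsLocalSpinorExpr.congr he hst)]

theorem covSpinor_zero (h : S.IsTanakaWebster cov) (x : M) (v : TangentSpace I x) :
    covSpinor h (fun _ ↦ 0) x v = 0 :=
  covSpinor_eq h (e := []) ⟨SmoothExpr.nil, Filter.Eventually.of_forall fun _ ↦ rfl⟩ v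

theorem covSpinor_add (h : S.IsTanakaWebster cov) (hs : S.SmoothSpinor s) (ht : S.SmoothSpinor t)
    (x : M) (v : TangentSpace I x) :
    covSpinor h (fun y ↦ s y + t y) x v = covSpinor h s x v + covSpinor h t x v := by
  obtain ⟨e, he⟩ := hs x
  obtain ⟨e', he'⟩ := ht x
  rw [covSpinor_eq h he, covSpinor_eq h he', covSpinor_eq h (IsLocalSpinorExpr.append he he'),
    exprDeriv_append]

theorem covSpinor_smul (h : S.IsTanakaWebster cov) {f : M → ℂ} (hf : ContMDiff I 𝓘(ℝ, ℂ) ∞ f)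
    (hs : S.SmoothSpinor s) (x : M) (v : TangentSpace I x) :
    covSpinor h (fun y ↦ f y • s y) x v = mvfderiv I f x v • s x + f x • covSpinor h s x v := by
  obtain ⟨e, he⟩ := hs x
  rw [covSpinor_eq h he, covSpinor_eq h (IsLocalSpinorExpr.scale he hf),
    exprDeriv_scaleExpr S.ιS v _ hf he.1, he.2.self_of_nhds]

theorem covSpinor_const_smul (h : S.IsTanakaWebster cov) (c : ℂ)
    (hs : S.SmoothSpinor s) (x : M) (v : TangentSpace I x) :
    covSpinor h (fun y ↦ c • s y) x v = c • covSpinor h s x v := by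
  have h1 : mvfderiv I (fun _ : M ↦ c) x = 0 := mvfderiv_const _
  rw [covSpinor_smul h (f := fun _ ↦ c) contMDiff_const hs, h1, zero_apply, zero_smul, zero_add]

theorem covSpinor_ιS_mul (h : S.IsTanakaWebster cov) {β : Π x : M, S.Eform01 x}
    (hβ : SmoothForm fun x ↦ (β x).1) (hs : S.SmoothSpinor s) (x : M) (v : TangentSpace I x) :
    covSpinor h (fun y ↦ S.ιS y (β y) * s y) x v
      = S.ιS x (covEform01 h β x v) * s x + S.ιS x (β x) * covSpinor h s x v := by
  obtain ⟨e, he⟩ := hs x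
  rw [covSpinor_eq h he, covSpinor_eq h (IsLocalSpinorExpr.cons he hβ), exprDeriv_consExpr,
    he.2.self_of_nhds]

theorem covSpinor_contraction (h : S.IsTanakaWebster cov) {Y : Π x : M, TangentSpace I x}
    (hY : SmoothField I Y) (hs : S.SmoothSpinor s) (x : M) (v : TangentSpace I x) :
    covSpinor h (fun y ↦ S.contraction y (Y y) (s y)) x v
      = S.contraction x (cov Y x v) (s x) + S.contraction x (Y x) (covSpinor h s x v) := by
  obtain ⟨e, he⟩ := hs x
  rw [covSpinor_eq h he, covSpinor_eq h (IsLocalSpinorExpr.contr he hY),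
    exprDeriv_contrExpr h hY he.1, he.2.self_of_nhds, add_comm]

theorem smoothSpinor_wordDeriv (h : S.IsTanakaWebster cov) {X : Π x : M, TangentSpace I x}
    (hX : SmoothField I X) {l : List (Π x : M, S.Eform01 x)}
    (hl : ∀ β ∈ l, SmoothForm fun x ↦ (β x).1) :
    S.SmoothSpinor fun y ↦ wordDeriv S.ιS y (fun β ↦ covEform01 h β y (X y)) l := by
  induction l with
  | nil => exact SmoothSpinor.zero
  | cons β l ih =>
    have hβ := hl β List.mem_cons_self
    have hl' := fun γ hγ ↦ hl γ (List.mem_cons_of_mem _ hγ)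
    exact ((SmoothSpinor.wordVal hl').ιS_mul (β := fun y ↦ covEform01 h β y (X y))
      (h.smoothForm_covForm hβ hX)).add ((ih hl').ιS_mul hβ)

theorem smoothSpinor_exprDeriv (h : S.IsTanakaWebster cov) {X : Π x : M, TangentSpace I x}
    (hX : SmoothField I X) {e : S.SpinorExpr} (he : S.SmoothSpinorExpr e) :
    S.SmoothSpinor fun y ↦ exprDeriv S.ιS y (X y) (fun β ↦ covEform01 h β y (X y)) e := by
  induction e with
  | nil => exact SmoothSpinor.zero
  | cons t e ih =>
    obtain ⟨h1, h2⟩ := he t List.mem_cons_self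
    simp only [exprDeriv_cons]
    exact (((SmoothSpinor.wordVal h2).smul (contMDiff_mvfderiv_apply h1 hX)).add
      ((smoothSpinor_wordDeriv h hX h2).smul h1)).add (ih he.of_cons)

theorem isSpinorConnection_covSpinor (h : S.IsTanakaWebster cov) :
    S.IsSpinorConnection (covSpinor h) where
  smooth s X hs hX := smoothSpinor_of_locally fun x ↦ by
    obtain ⟨e, he⟩ := hs x
    refine ⟨_, smoothSpinor_exprDeriv h hX he.1, ?_⟩
    filter_upwards [he.2.eventually_nhds] with y hy
    exact (covSpinor_eq h ⟨he.1, hy⟩ (X y)).symm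
  map_add s x v w hs := by
    obtain ⟨e, he⟩ := hs x
    rw [covSpinor_eq h he, covSpinor_eq h he, covSpinor_eq h he, exprDeriv_add h he.1]
  map_smul s x v c hs := by
    obtain ⟨e, he⟩ := hs x
    rw [covSpinor_eq h he, covSpinor_eq h he, exprDeriv_smul h he.1]
  add s t x v hs ht := covSpinor_add h hs ht x v
  leibniz f s x v hf hs := covSpinor_smul h hf hs x v

/-! ### The Clifford action is parallel -/

theorem SmoothSpinor.cliffordAction_ιCl {α : Π x : M, S.Estar x}
    (hα : SmoothForm fun x ↦ (α x).1) (hs : S.SmoothSpinor s) :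
    S.SmoothSpinor fun y ↦ S.cliffordAction y (S.ιCl y (α y)) (s y) := by
  simp only [PseudohermitianStructure.cliffordAction_ιCl]
  exact ((hs.ιS_mul (smoothForm_part01 hα)).smul contMDiff_const).add
    ((hs.contraction (S.smoothField_sharp hα)).smul contMDiff_const)

/-- The Clifford action of covectors is parallel: `∇ (c(α) s) = c(∇ α) s + c(α) ∇ s`. -/
theorem covSpinor_cliffordAction_ιCl (h : S.IsTanakaWebster cov) {α : Π x : M, S.Estar x}
    (hα : SmoothForm fun x ↦ (α x).1) (hs : S.SmoothSpinor s) (x : M) (v : TangentSpace I x) :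
    covSpinor h (fun y ↦ S.cliffordAction y (S.ιCl y (α y)) (s y)) x v
      = S.cliffordAction x (S.ιCl x (covEstar h α x v)) (s x)
        + S.cliffordAction x (S.ιCl x (α x)) (covSpinor h s x v) := by
  have h1 := smoothForm_part01 hα
  have h2 := S.smoothField_sharp hα
  simp only [cliffordAction_ιCl]
  rw [covSpinor_add h ((hs.ιS_mul h1).smul contMDiff_const)
      ((hs.contraction h2).smul contMDiff_const),
    covSpinor_const_smul h _ (hs.ιS_mul h1), covSpinor_const_smul h _ (hs.contraction h2),
    covSpinor_ιS_mul h h1 hs, covSpinor_contraction h h2 hs, h.covEform01_part01 hα,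
    h.cov_sharp hα]
  change _ + _ • (S.contraction x (S.sharp x (covEstar h α x v).1) (s x) + _) = _
  module

theorem SmoothSpinor.cliffordAction_wordVal {l : List (Π x : M, S.Estar x)}
    (hl : ∀ α ∈ l, SmoothForm fun x ↦ (α x).1) (hs : S.SmoothSpinor s) :
    S.SmoothSpinor fun y ↦
      S.cliffordAction y (PseudohermitianStructure.wordVal S.ιCl l y) (s y) := by
  induction l with
  | nil => simpa using hs
  | cons α l ih =>
    simp only [wordVal_cons, cliffordAction_mul_apply]
    exact (ih fun γ hγ ↦ hl γ (List.mem_cons_of_mem _ hγ)).cliffordAction_ιCl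
      (hl α List.mem_cons_self)

theorem covSpinor_cliffordAction_wordVal (h : S.IsTanakaWebster cov)
    {l : List (Π x : M, S.Estar x)} (hl : ∀ α ∈ l, SmoothForm fun x ↦ (α x).1)
    (hs : S.SmoothSpinor s) (x : M) (v : TangentSpace I x) :
    covSpinor h (fun y ↦ S.cliffordAction y (wordVal S.ιCl l y) (s y)) x v
      = S.cliffordAction x (wordDeriv S.ιCl x (fun α ↦ covEstar h α x v) l) (s x)
        + S.cliffordAction x (wordVal S.ιCl l x) (covSpinor h s x v) := by
  induction l with
  | nil => simp [wordDeriv]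
  | cons α l ih =>
    have hα := hl α List.mem_cons_self
    have hl' := fun γ hγ ↦ hl γ (List.mem_cons_of_mem _ hγ)
    simp only [wordVal_cons, wordDeriv, cliffordAction_mul_apply, cliffordAction_add_apply]
    rw [covSpinor_cliffordAction_ιCl h hα (hs.cliffordAction_wordVal hl'), ih hl', map_add,
      add_assoc]

/-- Formal finite sums of products of functions and sections of `E^*`. -/
abbrev ClExpr (S : PseudohermitianStructure I M) : Type _ := Expr fun x : M ↦ S.Estar x

/-- `e` is an expression in smooth functions and smooth sections of `E^*`. -/
abbrev SmoothClExpr (S : PseudohermitianStructure I M) (e : S.ClExpr) : Prop :=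
  SmoothExpr I (fun α : Π x : M, S.Estar x ↦ SmoothForm fun x ↦ (α x).1) e

theorem SmoothSpinor.cliffordAction_exprVal {e : S.ClExpr} (he : S.SmoothClExpr e)
    (hs : S.SmoothSpinor s) :
    S.SmoothSpinor fun y ↦ S.cliffordAction y (exprVal S.ιCl e y) (s y) := by
  induction e with
  | nil => simpa using SmoothSpinor.zero
  | cons t e ih =>
    obtain ⟨h1, h2⟩ := he t List.mem_cons_self
    simp only [exprVal_cons, cliffordAction_add_apply, cliffordAction_smul_apply]
    exact ((hs.cliffordAction_wordVal h2).smul h1).add (ih he.of_cons)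

/-- The Leibniz rule for the Clifford action of an expression; it holds for whichever expression
computes the connection on `Cl(E)`. -/
theorem covSpinor_cliffordAction_exprVal (h : S.IsTanakaWebster cov) {e : S.ClExpr}
    (he : S.SmoothClExpr e) (hs : S.SmoothSpinor s) (x : M) (v : TangentSpace I x) :
    covSpinor h (fun y ↦ S.cliffordAction y (exprVal S.ιCl e y) (s y)) x v
      = S.cliffordAction x (exprDeriv S.ιCl x v (fun α ↦ covEstar h α x v) e) (s x)
        + S.cliffordAction x (exprVal S.ιCl e x) (covSpinor h s x v) := by
  induction e with
  | nil => simp [covSpinor_zero]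
  | cons t e ih =>
    obtain ⟨h1, h2⟩ := he t List.mem_cons_self
    simp only [exprVal_cons, exprDeriv_cons, cliffordAction_add_apply, cliffordAction_smul_apply]
    rw [covSpinor_add h ((hs.cliffordAction_wordVal h2).smul h1)
        (hs.cliffordAction_exprVal he.of_cons),
      covSpinor_smul h h1 (hs.cliffordAction_wordVal h2),
      covSpinor_cliffordAction_wordVal h h2 hs, ih he.of_cons]
    module

theorem isCRCliffordConnection_covSpinor (h : S.IsTanakaWebster cov) :
    IsCRCliffordConnection h (covSpinor h) where
  isConnection := isSpinorConnection_covSpinor h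
  action_smooth a s ha hs := smoothSpinor_of_locally fun x ↦ by
    obtain ⟨e, he⟩ := ha x
    refine ⟨_, hs.cliffordAction_exprVal he.1, ?_⟩
    filter_upwards [he.2] with y hy
    rw [hy]
  commutator a X ha _ s hs x := by
    rw [covCl, inducedConnection, dif_pos (ha x)]
    obtain ⟨h1, h2⟩ := (ha x).choose_spec
    set e := (ha x).choose
    have h3 := covSpinor_congr h (hs.cliffordAction_exprVal h1)
      (t := fun y ↦ S.cliffordAction y (a y) (s y))
      (by filter_upwards [h2] with y hy; rw [hy]) (X x)
    rw [← h3, covSpinor_cliffordAction_exprVal h h1 hs, h2.self_of_nhds, add_sub_cancel_right]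

end Connection

end PseudohermitianStructure

end CRClifford

end

theorem mainTheorem10 (n : ℕ) (M : Type*) [TopologicalSpace M] [T2Space M] [SigmaCompactSpace M]
    [ChartedSpace (EuclideanSpace ℝ (Fin (2 * n + 1))) M]
    [IsManifold (modelWithCornersSelf ℝ (EuclideanSpace ℝ (Fin (2 * n + 1)))) ∞ M]
    (S : CRClifford.PseudohermitianStructure
      (modelWithCornersSelf ℝ (EuclideanSpace ℝ (Fin (2 * n + 1)))) M)
    (cov : CovariantDerivative (modelWithCornersSelf ℝ (EuclideanSpace ℝ (Fin (2 * n + 1))))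
      (EuclideanSpace ℝ (Fin (2 * n + 1)))
      (TangentSpace (modelWithCornersSelf ℝ (EuclideanSpace ℝ (Fin (2 * n + 1)))) :
        M → Type _))
    (hcov : S.IsTanakaWebster cov) :
    CRClifford.PseudohermitianStructure.IsCRCliffordConnection hcov
      (CRClifford.PseudohermitianStructure.covSpinor hcov) := by
  exact CRClifford.PseudohermitianStructure.isCRCliffordConnection_covSpinor hcov
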